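/- Notation. For an object $T$ of an abelian category with coproducts, $\mathrm{Add}(T)$ is the class of direct summands of coproducts $T^{(X)}$ of copies of $T$, over all sets $X$. The object $T$ is weakly tilting if $\mathrm{Ext}^i(T,T^{(X)})=0$ for all sets $X$ and all $i>0$. The full subcategory $\mathsf E_{\max}(T)$ consists of the objects $E$ such that $\mathrm{Ext}^i(T,E)=0$ for all $i>0$ and there is an exact sequence $\cdots\to T_1\to T_0\to E\to 0$ with all $T_j\in\mathrm{Add}(T)$ that remains exact after applying $\mathrm{Hom}(T,-)$. If the category also has products and an injective cogenerator, $T$ is $\infty$-tilting if it is weakly tilting and every injective object lies in $\mathsf E_{\max}(T)$. Dually, in an abelian category with products, $\mathrm{Prod}(W)$ is the class of direct summands of products $W^X$ of copies of $W$, and $W$ is weakly cotilting if $\mathrm{Ext}^i(W^X,W)=0$ for all sets $X$ and all $i>0$. The full subcategory $\mathsf F_{\max}(W)$ consists of the objects $F$ such that $\mathrm{Ext}^i(F,W)=0$ for all $i>0$ and there is an exact sequence $0\to F\to W^0\to W^1\to\cdots$ with all $W^j\in\mathrm{Prod}(W)$ that remains exact after applying $\mathrm{Hom}(-,W)$. If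 the category also has coproducts and a projective generator, $W$ is $\infty$-cotilting if it is weakly cotilting and every projective object lies in $\mathsf F_{\max}(W)$. The subcategories $\mathsf E_{\max}(T)$, for $T$ weakly tilting, and $\mathsf F_{\max}(W)$, for $W$ weakly cotilting, are closed under extensions and carry the inherited exact structures. For an object $T$ of a complete, cocomplete abelian category $\mathsf A$, let $\sigma_T(\mathsf A)$ be the abelian category of modules (algebras) over the monad $X\mapsto\mathrm{Hom}(T,T^{(X)})$ on the category of sets, let $\Psi\colon\mathsf A\to\sigma_T(\mathsf A)$ be the functor $N\mapsto\mathrm{Hom}(T,N)$, and let $\Phi$ be the left adjoint of $\Psi$. Dually, for an object $W$ of a complete, cocomplete abelian category $\mathsf B$, let $\pi_W(\mathsf B)$ be the opposite of the category of modules over the monad $X\mapsto\mathrm{Hom}(W^X,W)$ on the category of sets, let $\Phi\colon\mathsf B\to\pi_W(\mathsf B)$ be the functor $N\mapsto\mathrm{Hom}(N,W)$, and let $\Psi$ be the right adjoint of $\Phi$. Theorem. (1) Let $\mathsf A$ be a complete, cocomplete abelian category with an injective cogenerator $J$ and an $\infty$-tilting object $T$. Put $\mathsf B=\sigma_T(\mathsf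 A)$, $P=\Psi(T)$ and $W=\Psi(J)$. Then $\mathsf B$ has enough projective objects; $\Phi$ and $\Psi$ restrict to mutually inverse equivalences between the full subcategory $\mathsf B_{\mathrm{proj}}$ of projective objects and $\mathrm{Add}(T)$; and $P$ is a projective generator of $\mathsf B$. Moreover, $W$ is an $\infty$-cotilting object of $\mathsf B$, and $\Psi$ and $\Phi$ restrict to mutually inverse equivalences of exact categories between $\mathsf E_{\max}(T)$ and $\mathsf F_{\max}(W)$. One has $T,J\in\mathsf E_{\max}(T)$ and $P,W\in\mathsf F_{\max}(W)$, and these equivalences identify $T$ with $P$ and $J$ with $W$. (2) Let $\mathsf B$ be a complete, cocomplete abelian category with a projective generator $P$ and an $\infty$-cotilting object $W$. Put $\mathsf A=\pi_W(\mathsf B)$, $J=\Phi(W)$ and $T=\Phi(P)$. Then $\mathsf A$ has enough injective objects; $\Phi$ and $\Psi$ restrict to mutually inverse equivalences between $\mathrm{Prod}(W)$ and the full subcategory $\mathsf A_{\mathrm{inj}}$ of injective objects; and $J$ is an injective cogenerator of $\mathsf A$. Moreover, $T$ is an $\infty$-tilting object of $\mathsf A$, and $\Phi$ and $\Psi$ restrict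 to mutually inverse equivalences of exact categories between $\mathsf F_{\max}(W)$ and $\mathsf E_{\max}(T)$. One has $W,P\in\mathsf F_{\max}(W)$ and $J,T\in\mathsf E_{\max}(T)$, and these equivalences identify $W$ with $J$ and $P$ with $T$. -/

import Mathlib

open CategoryTheory CategoryTheory.Limits Opposite

universe v u

namespace TiltingTheory

section Tilted

variable {A : Type u} [Category.{v} A] [HasCoproducts.{v} A]

/-- The monad `X ↦ Hom(T, T^(X))` on the category of sets, coming from the adjunction between
`X ↦ T^(X)` and `N ↦ Hom(T, N)`. -/
noncomputable abbrev tiltingMonad (T : A) : Monad (Type v) := (sigmaConstAdj.{v} T).toMonad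

/-- The abelian category `σ_T(A)`: the category of modules (Eilenberg-Moore algebras) over the
monad `X ↦ Hom(T, T^(X))` on the category of sets. -/
abbrev Tilted (T : A) : Type (v + 1) := (tiltingMonad T).Algebra

namespace Tilted

variable {T : A}

lemma sigmaConst_map {Y Z : Type v} (f : Y ⟶ Z) :
    (sigmaConst.obj T).map f = Sigma.desc fun y => Sigma.ι (fun _ : Z => T) (f y) :=
  colimit.hom_ext fun ⟨y⟩ => by simp

/-- The structure map of a module over the monad, as a function. -/
noncomputable def act (X : Tilted T) (g : T ⟶ ∐ fun _ : X.A => T) : X.A := X.a g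

lemma act_ι (X : Tilted T) (x : X.A) : X.act (Sigma.ι (fun _ : X.A => T) x) = x :=
  types_congr_hom X.unit x

lemma act_desc (X : Tilted T) {Y : Type v} (w : T ⟶ ∐ fun _ : Y => T)
    (h : Y → (T ⟶ ∐ fun _ : X.A => T)) :
    X.act (w ≫ Sigma.desc h) =
      X.act (w ≫ Sigma.desc fun y => Sigma.ι (fun _ : X.A => T) (X.act (h y))) := by
  have key : ∀ w' : T ⟶ ∐ fun _ : (T ⟶ ∐ fun _ : X.A => T) => T,
      X.act (w' ≫ Sigma.desc id) =
        X.act (w' ≫ Sigma.desc fun g => Sigma.ι (fun _ : X.A => T) (X.act g)) := fun w' =>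
    (types_congr_hom X.assoc w').trans
      (congrArg (fun t => X.act (w' ≫ t)) (sigmaConst_map X.a))
  have := key (w ≫ Sigma.map' h fun _ => 𝟙 T)
  convert this using 2
  · rw [Category.assoc]
    congr 1
    ext y
    simp
  · rw [Category.assoc]
    congr 1
    ext y
    simp

lemma map_act {X Y : Tilted T} (f : X ⟶ Y) (g : T ⟶ ∐ fun _ : X.A => T) :
    f.f (X.act g) = Y.act (g ≫ Sigma.desc fun x => Sigma.ι (fun _ : Y.A => T) (f.f x)) := by
  have := types_congr_hom f.h g
  refine this.symm.trans ?_
  change Y.act _ = _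
  congr 1
  exact congrArg (g ≫ ·) (sigmaConst_map f.f)

/-- A map of sets commuting with all operations is a morphism of modules over the monad. -/
noncomputable def homMk {X Y : Tilted T} (f : X.A → Y.A)
    (hf : ∀ g : T ⟶ ∐ fun _ : X.A => T,
      f (X.act g) = Y.act (g ≫ Sigma.desc fun x => Sigma.ι (fun _ : Y.A => T) (f x))) :
    X ⟶ Y where
  f := ↾f
  h := by
    ext g
    refine Eq.trans ?_ (hf g).symm
    exact congrArg (fun t => Y.act (g ≫ t)) (sigmaConst_map (↾f))

@[simp] lemma homMk_apply {X Y : Tilted T} (f : X.A → Y.A) (hf) (x : X.A) :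
    (homMk (X := X) (Y := Y) f hf).f x = f x := rfl

/-- A module over the monad from its operations. -/
noncomputable def mk' (Z : Type v) (op : (T ⟶ ∐ fun _ : Z => T) → Z)
    (unit : ∀ z, op (Sigma.ι (fun _ : Z => T) z) = z)
    (assoc : ∀ {Y : Type v} (w : T ⟶ ∐ fun _ : Y => T) (h : Y → (T ⟶ ∐ fun _ : Z => T)),
      op (w ≫ Sigma.desc h) = op (w ≫ Sigma.desc fun y => Sigma.ι (fun _ : Z => T) (op (h y)))) :
    Tilted T where
  A := Z
  a := ↾op
  unit := by ext z; exact unit z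
  assoc := by
    ext w
    refine (assoc w id).trans ?_
    exact (congrArg (fun t => op (w ≫ t)) (sigmaConst_map (↾op))).symm

@[simp] lemma mk'_act (Z : Type v) (op : (T ⟶ ∐ fun _ : Z => T) → Z) (unit) (assoc)
    (g : T ⟶ ∐ fun _ : Z => T) : (mk' Z op unit assoc).act g = op g := rfl

lemma hom_ext {X Y : Tilted T} {f g : X ⟶ Y} (h : ∀ x, f.f x = g.f x) : f = g := by
  apply Monad.Algebra.Hom.ext'
  ext x
  exact h x


lemma act_surjective (X : Tilted T) : Function.Surjective X.act := fun x => ⟨_, X.act_ι x⟩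

end Tilted
end Tilted

section Preadditive

set_option linter.unusedSectionVars false

variable {A : Type u} [Category.{v} A] [Preadditive A] [HasCoproducts.{v} A] {T : A}

namespace Tilted

lemma act_add (X : Tilted T) (g h : T ⟶ ∐ fun _ : X.A => T) :
    X.act (g + h) = X.act (Sigma.ι (fun _ : X.A => T) (X.act g) +
      Sigma.ι (fun _ : X.A => T) (X.act h)) := by
  have := X.act_desc (Sigma.ι (fun _ : ULift.{v} Bool => T) ⟨true⟩ +
    Sigma.ι (fun _ : ULift.{v} Bool => T) ⟨false⟩) (fun b => if b.down then g else h)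
  simpa [Preadditive.add_comp] using this

lemma act_neg (X : Tilted T) (g : T ⟶ ∐ fun _ : X.A => T) :
    X.act (-g) = X.act (-Sigma.ι (fun _ : X.A => T) (X.act g)) := by
  have := X.act_desc (-Sigma.ι (fun _ : PUnit.{v + 1} => T) ⟨⟩) (fun _ => g)
  simpa [Preadditive.neg_comp] using this

/-- The additive group structure on the underlying set of a module over the monad. -/
noncomputable abbrev addCommGroup (X : Tilted T) : AddCommGroup X.A :=
  letI : Add X.A := ⟨fun x y =>
    X.act (Sigma.ι (fun _ : X.A => T) x + Sigma.ι (fun _ : X.A => T) y)⟩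
  letI : Zero X.A := ⟨X.act 0⟩
  letI : Neg X.A := ⟨fun x => X.act (-Sigma.ι (fun _ : X.A => T) x)⟩
  have hadd : ∀ g h, X.act g + X.act h = X.act (g + h) := fun g h => (X.act_add g h).symm
  have hneg : ∀ g, -X.act g = X.act (-g) := fun g => (X.act_neg g).symm
  have hcomm : ∀ x y : X.A, x + y = y + x := fun x y => by
    obtain ⟨x, rfl⟩ := X.act_surjective x
    obtain ⟨y, rfl⟩ := X.act_surjective y
    rw [hadd, hadd, add_comm]
  { add := (· + ·), zero := 0, neg := Neg.neg
    add_assoc := fun x y z => by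
      obtain ⟨x, rfl⟩ := X.act_surjective x
      obtain ⟨y, rfl⟩ := X.act_surjective y
      obtain ⟨z, rfl⟩ := X.act_surjective z
      rw [hadd, hadd, hadd, hadd, add_assoc]
    zero_add := fun x => by
      obtain ⟨x, rfl⟩ := X.act_surjective x
      exact (hadd 0 x).trans (by rw [zero_add])
    add_zero := fun x => by
      obtain ⟨x, rfl⟩ := X.act_surjective x
      exact (hadd x 0).trans (by rw [add_zero])
    neg_add_cancel := fun x => by
      obtain ⟨x, rfl⟩ := X.act_surjective x
      rw [hneg, hadd, neg_add_cancel]; rfl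
    add_comm := hcomm
    nsmul := nsmulRec
    zsmul := zsmulRec }

attribute [local instance] addCommGroup

lemma act_add' (X : Tilted T) (g h : T ⟶ ∐ fun _ : X.A => T) :
    X.act (g + h) = X.act g + X.act h := X.act_add g h

/-- The structure map as a homomorphism of groups. -/
noncomputable def actHom (X : Tilted T) : (T ⟶ ∐ fun _ : X.A => T) →+ X.A :=
  AddMonoidHom.mk' X.act X.act_add'

lemma actHom_apply (X : Tilted T) (g : T ⟶ ∐ fun _ : X.A => T) : X.actHom g = X.act g := rfl

lemma map_add {X Y : Tilted T} (f : X ⟶ Y) (x y : X.A) : f.f (x + y) = f.f x + f.f y := by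
  change f.f (X.act _) = Y.act _
  rw [map_act, Preadditive.add_comp]
  simp

/-- The underlying group homomorphism of a morphism. -/
noncomputable def addHom {X Y : Tilted T} (f : X ⟶ Y) : X.A →+ Y.A :=
  AddMonoidHom.mk' (fun x => f.f x) (map_add f)

@[simp] lemma addHom_apply {X Y : Tilted T} (f : X ⟶ Y) (x : X.A) : addHom f x = f.f x := rfl

/-- The group of families of morphisms out of `T^(Y)`, as a group homomorphism. -/
noncomputable def descHom {Y : Type v} {N : A} (w : T ⟶ ∐ fun _ : Y => T) :
    (Y → (T ⟶ N)) →+ (T ⟶ N) :=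
  AddMonoidHom.mk' (fun h => w ≫ Sigma.desc h) fun h h' => by
    rw [← Preadditive.comp_add]
    congr 1
    ext y
    simp

lemma descHom_apply {Y : Type v} {N : A} (w : T ⟶ ∐ fun _ : Y => T) (h : Y → (T ⟶ N)) :
    descHom w h = w ≫ Sigma.desc h := rfl

/-- Any additive operation on families induces the same operation on morphisms. -/
lemma act_descHom (X : Tilted T) {Y : Type v} (w : T ⟶ ∐ fun _ : Y => T)
    (h : Y → (T ⟶ ∐ fun _ : X.A => T)) :
    X.act (w ≫ Sigma.desc fun y => Sigma.ι (fun _ : X.A => T) (X.act (h y))) =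
      X.actHom (descHom w h) := (X.act_desc w h).symm

noncomputable instance (X Y : Tilted T) : Add (X ⟶ Y) where
  add f g := homMk (fun x => f.f x + g.f x) fun w => by
    rw [map_act, map_act, ← act_add']
    refine Eq.trans ?_ (Y.act_descHom w fun x => Sigma.ι (fun _ : Y.A => T) (f.f x) +
      Sigma.ι (fun _ : Y.A => T) (g.f x)).symm
    rw [actHom_apply]
    congr 1
    exact ((descHom w).map_add _ _).symm

noncomputable instance (X Y : Tilted T) : Neg (X ⟶ Y) where
  neg f := homMk (fun x => -f.f x) fun w => by
    rw [map_act, ← actHom_apply, ← AddMonoidHom.map_neg]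
    refine Eq.trans ?_ (Y.act_descHom w fun x => -Sigma.ι (fun _ : Y.A => T) (f.f x)).symm
    congr 1
    exact ((descHom w).map_neg _).symm

noncomputable instance (X Y : Tilted T) : Zero (X ⟶ Y) where
  zero := homMk (fun _ => 0) fun w => by
    refine Eq.trans ?_ (Y.act_descHom w 0).symm
    rw [(descHom w).map_zero, map_zero]

lemma add_f {X Y : Tilted T} (f g : X ⟶ Y) (x : X.A) : (f + g).f x = f.f x + g.f x := rfl
lemma neg_f {X Y : Tilted T} (f : X ⟶ Y) (x : X.A) : (-f).f x = -f.f x := rfl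
lemma zero_f {X Y : Tilted T} (x : X.A) : (0 : X ⟶ Y).f x = 0 := rfl

noncomputable instance (X Y : Tilted T) : AddCommGroup (X ⟶ Y) where
  add_assoc f g h := hom_ext fun x => by simp only [add_f, add_assoc]
  zero_add f := hom_ext fun x => by simp only [add_f, zero_f, zero_add]
  add_zero f := hom_ext fun x => by simp only [add_f, zero_f, add_zero]
  neg_add_cancel f := hom_ext fun x => by simp only [add_f, neg_f, zero_f, neg_add_cancel]
  add_comm f g := hom_ext fun x => by simp only [add_f, add_comm]
  nsmul := nsmulRec
  zsmul := zsmulRec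

/-- Morphisms are added pointwise. -/
noncomputable instance preadditive : Preadditive (Tilted T) where
  add_comp X Y Z f f' g := hom_ext fun x => map_add g _ _
  comp_add X Y Z f g g' := hom_ext fun x => rfl

instance (T : A) : HasLimits (Tilted T) :=
  hasLimits_of_hasLimits_createsLimits (tiltingMonad T).forget

lemma injective_of_mono {X Y : Tilted T} (f : X ⟶ Y) [Mono f] :
    Function.Injective (fun x => f.f x) := by
  have : Mono ((tiltingMonad T).forget.map f) := inferInstance
  exact (mono_iff_injective _).1 this

section Cokernel

variable {X Y : Tilted T} (f : X ⟶ Y)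

/-- The underlying set of the cokernel. -/
abbrev CokerCarrier : Type v := Y.A ⧸ (addHom f).range

/-- The operations on the cokernel, computed on representatives. -/
noncomputable def cokerOp (g : T ⟶ ∐ fun _ : CokerCarrier f => T) : CokerCarrier f :=
  QuotientAddGroup.mk (Y.act (g ≫ Sigma.desc fun z =>
    Sigma.ι (fun _ : Y.A => T) (Quotient.out z)))

/-- Families that agree modulo the image give results that agree modulo the image. -/
lemma act_congr {Z : Type v} (w : T ⟶ ∐ fun _ : Z => T) (a b : Z → Y.A)
    (h : ∀ z, (QuotientAddGroup.mk (a z) : CokerCarrier f) = QuotientAddGroup.mk (b z)) :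
    (QuotientAddGroup.mk (Y.act (w ≫ Sigma.desc fun z => Sigma.ι (fun _ : Y.A => T) (a z))) :
        CokerCarrier f) =
      QuotientAddGroup.mk (Y.act (w ≫ Sigma.desc fun z => Sigma.ι (fun _ : Y.A => T) (b z))) := by
  simp only [QuotientAddGroup.eq, AddMonoidHom.mem_range, addHom_apply] at h
  choose c hc using h
  rw [QuotientAddGroup.eq]
  refine ⟨X.act (w ≫ Sigma.desc fun z => Sigma.ι (fun _ : X.A => T) (c z)), ?_⟩
  rw [addHom_apply, map_act, ← actHom_apply Y, ← actHom_apply Y, ← actHom_apply Y, ← map_neg,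
    ← _root_.map_add, Category.assoc]
  have h1 : (Sigma.desc fun z => Sigma.ι (fun _ : X.A => T) (c z)) ≫
      (Sigma.desc fun x => Sigma.ι (fun _ : Y.A => T) (f.f x)) =
      Sigma.desc fun z => Sigma.ι (fun _ : Y.A => T)
        (Y.act (-Sigma.ι (fun _ : Y.A => T) (a z) + Sigma.ι (fun _ : Y.A => T) (b z))) := by
    ext z
    simp only [Sigma.ι_desc, Sigma.ι_desc_assoc, hc]
    congr 1
    rw [act_add', ← actHom_apply, ← actHom_apply, map_neg, actHom_apply, actHom_apply, act_ι,
      act_ι]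
  rw [h1, actHom_apply, act_descHom]
  congr 1
  exact ((descHom w).map_add _ _).trans (congrArg (· + _) ((descHom w).map_neg _))

lemma cokerOp_mk {Z : Type v} (w : T ⟶ ∐ fun _ : Z => T) (b : Z → Y.A) :
    cokerOp f (w ≫ Sigma.desc fun z => Sigma.ι (fun _ : CokerCarrier f => T) (b z : CokerCarrier f)) =
      QuotientAddGroup.mk (Y.act (w ≫ Sigma.desc fun z => Sigma.ι (fun _ : Y.A => T) (b z))) := by
  rw [cokerOp, Category.assoc]
  have h1 : (Sigma.desc fun z => Sigma.ι (fun _ : CokerCarrier f => T) (b z : CokerCarrier f)) ≫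
      (Sigma.desc fun z => Sigma.ι (fun _ : Y.A => T) (Quotient.out z)) =
      Sigma.desc fun z => Sigma.ι (fun _ : Y.A => T) (Quotient.out (b z : CokerCarrier f)) := by
    ext z
    simp
  rw [h1]
  exact act_congr f w _ _ fun z => Quotient.out_eq _

/-- The cokernel of a morphism: the quotient group with the induced operations. -/
noncomputable def coker : Tilted T :=
  mk' (CokerCarrier f) (cokerOp f)
    (fun z => by
      rw [cokerOp]
      simp only [Sigma.ι_desc]
      rw [act_ι]
      exact Quotient.out_eq z)
    (fun {Z} w h => by
      have e : ∀ z, cokerOp f (h z) = QuotientAddGroup.mk (Y.act (h z ≫ Sigma.desc fun z =>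
        Sigma.ι (fun _ : Y.A => T) (Quotient.out z))) := fun z => rfl
      simp only [e]
      rw [cokerOp_mk, cokerOp, ← act_desc, Category.assoc]
      congr 3
      ext z
      simp)

/-- The projection to the cokernel. -/
noncomputable def cokerπ : Y ⟶ coker f :=
  homMk (Y := coker f) (fun y => (QuotientAddGroup.mk y : CokerCarrier f)) fun g => by
    have := cokerOp_mk f g id
    simp only [id] at this
    refine Eq.trans ?_ this.symm
    congr 2
    have : (Sigma.desc fun z => Sigma.ι (fun _ : Y.A => T) z) = 𝟙 _ := by
      ext; simp
    rw [this, Category.comp_id]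

lemma cokerπ_surjective : Function.Surjective (fun y => (cokerπ f).f y) :=
  QuotientAddGroup.mk_surjective

lemma cokerπ_eq_iff (y y' : Y.A) : (cokerπ f).f y = (cokerπ f).f y' ↔ ∃ x, f.f x = -y + y' :=
  QuotientAddGroup.eq

lemma map_zero' {X Y : Tilted T} (f : X ⟶ Y) : f.f (0 : X.A) = 0 := map_zero (addHom f)

lemma map_neg' {X Y : Tilted T} (f : X ⟶ Y) (x : X.A) : f.f (-x) = -f.f x := map_neg (addHom f) x

lemma comp_cokerπ : f ≫ cokerπ f = 0 := by
  refine hom_ext fun x => ?_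
  change (cokerπ f).f (f.f x) = 0
  rw [← map_zero' (cokerπ f), cokerπ_eq_iff]
  exact ⟨-x, by rw [map_neg', add_zero]⟩

end Cokernel

/-- A surjective morphism through which another one factors on the level of sets. -/
noncomputable def descOfSurjective {X Y Z : Tilted T} (p : X ⟶ Y)
    (hp : Function.Surjective (fun x => p.f x)) (g : X ⟶ Z)
    (h : ∀ x x', p.f x = p.f x' → g.f x = g.f x') : Y ⟶ Z :=
  homMk (fun y => g.f (hp y).choose) fun w => by
    have e : ∀ x, g.f (hp (p.f x)).choose = g.f x := fun x => h _ _ (hp (p.f x)).choose_spec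
    have hw : w = (w ≫ Sigma.desc fun y => Sigma.ι (fun _ : X.A => T) (hp y).choose) ≫
        Sigma.desc fun x => Sigma.ι (fun _ : Y.A => T) (p.f x) := by
      rw [Category.assoc]
      conv_lhs => rw [← Category.comp_id w]
      congr 1
      ext y
      have := (hp y).choose_spec
      simp only at this
      simp [this]
    conv_lhs => rw [hw, ← map_act, e, map_act, Category.assoc]
    congr 2
    ext y
    simp

lemma comp_descOfSurjective {X Y Z : Tilted T} (p : X ⟶ Y)
    (hp : Function.Surjective (fun x => p.f x)) (g : X ⟶ Z)
    (h : ∀ x x', p.f x = p.f x' → g.f x = g.f x') : p ≫ descOfSurjective p hp g h = g :=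
  hom_ext fun x => h _ _ (hp (p.f x)).choose_spec

lemma epi_of_surjective {X Y : Tilted T} (p : X ⟶ Y)
    (hp : Function.Surjective (fun x => p.f x)) : Epi p where
  left_cancellation g h e := hom_ext fun y => by
    obtain ⟨x, rfl⟩ := hp y
    exact types_congr_hom (congrArg Monad.Algebra.Hom.f e) x

instance {X Y : Tilted T} (f : X ⟶ Y) : Epi (cokerπ f) :=
  epi_of_surjective _ (cokerπ_surjective f)

/-- The morphism induced on the cokernel. -/
noncomputable def cokerDesc {X Y Z : Tilted T} (f : X ⟶ Y) (g : Y ⟶ Z) (hg : f ≫ g = 0) :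
    coker f ⟶ Z :=
  descOfSurjective _ (cokerπ_surjective f) g fun x x' hx => by
    obtain ⟨y, hy⟩ := (cokerπ_eq_iff f x x').1 hx
    have h0 : g.f (f.f y) = 0 := types_congr_hom (congrArg Monad.Algebra.Hom.f hg) y
    rw [hy, map_add, map_neg'] at h0
    exact neg_add_eq_zero.1 h0

lemma cokerπ_desc {X Y Z : Tilted T} (f : X ⟶ Y) (g : Y ⟶ Z) (hg : f ≫ g = 0) :
    cokerπ f ≫ cokerDesc f g hg = g :=
  comp_descOfSurjective _ _ _ _

instance : HasCokernels (Tilted T) where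
  has_colimit {X Y} f :=
    ⟨⟨⟨CokernelCofork.ofπ (cokerπ f) (comp_cokerπ f),
      CokernelCofork.IsColimit.ofπ _ _ (fun g hg => cokerDesc f g hg)
        (fun g hg => cokerπ_desc f g hg)
        (fun g hg m hm => by rw [← cancel_epi (cokerπ f), hm, cokerπ_desc])⟩⟩⟩

lemma surjective_of_epi {X Y : Tilted T} (f : X ⟶ Y) [Epi f] :
    Function.Surjective (fun x => f.f x) := by
  have h : cokerπ f = 0 := by rw [← cancel_epi f, comp_cokerπ, comp_zero]
  intro y
  have : (cokerπ f).f 0 = (cokerπ f).f y := by rw [h]; rfl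
  obtain ⟨x, hx⟩ := (cokerπ_eq_iff f 0 y).1 this
  exact ⟨x, by simpa using hx⟩

/-- Elements of a module are morphisms from the free module on one generator. -/
lemma exists_hom (X : Tilted T) (x : X.A) :
    ∃ φ : (tiltingMonad T).free.obj PUnit.{v + 1} ⟶ X,
      φ.f (Sigma.ι (fun _ : PUnit.{v + 1} => T) ⟨⟩) = x ∧
      ∀ ψ : (tiltingMonad T).free.obj PUnit.{v + 1} ⟶ X,
        ψ.f (Sigma.ι (fun _ : PUnit.{v + 1} => T) ⟨⟩) = x → ψ = φ := by
  refine ⟨((tiltingMonad T).adj.homEquiv _ _).symm (↾fun _ => x), ?_, ?_⟩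
  · have := ((tiltingMonad T).adj.homEquiv _ _).apply_symm_apply
      (↾fun _ : PUnit.{v + 1} => x)
    exact types_congr_hom this ⟨⟩
  · intro ψ hψ
    rw [Equiv.eq_symm_apply]
    ext ⟨⟩
    exact hψ

noncomputable instance : IsNormalMonoCategory (Tilted T) where
  normalMonoOfMono {X Y} f _ := by
    have hf := injective_of_mono f
    refine ⟨⟨_, cokerπ f, comp_cokerπ f, ?_⟩⟩
    have hx : ∀ {Z} (g : Z ⟶ Y), g ≫ cokerπ f = 0 → ∀ z, ∃ x, f.f x = g.f z := by
      intro Z g hg z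
      have h0 : (cokerπ f).f 0 = (cokerπ f).f (g.f z) :=
        (map_zero' _).trans (types_congr_hom (congrArg Monad.Algebra.Hom.f hg) z).symm
      obtain ⟨x, hx⟩ := (cokerπ_eq_iff f _ _).1 h0
      exact ⟨x, by simpa using hx⟩
    refine KernelFork.IsLimit.ofι _ _
      (fun {Z} g hg => homMk (fun z => (hx g hg z).choose) fun w => hf ?_)
      (fun {Z} g hg => hom_ext fun z => (hx g hg z).choose_spec)
      (fun {Z} g hg m hm => by rw [← cancel_mono f, hm]
                               exact (hom_ext fun z => (hx g hg z).choose_spec).symm)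
    have e : ∀ z, f.f (hx g hg z).choose = g.f z := fun z => (hx g hg z).choose_spec
    refine (e _).trans ?_
    change g.f _ = f.f _
    rw [map_act, map_act, Category.assoc]
    congr 2
    refine Sigma.hom_ext _ _ fun z => ?_
    simp [e]

noncomputable instance : IsNormalEpiCategory (Tilted T) where
  normalEpiOfEpi {X Y} f _ := by
    have hf := surjective_of_epi f
    refine ⟨⟨_, kernel.ι f, kernel.condition f, ?_⟩⟩
    have hd : ∀ {Z} (g : X ⟶ Z), kernel.ι f ≫ g = 0 →
        ∀ x x', f.f x = f.f x' → g.f x = g.f x' := by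
      intro Z g hg x x' hx
      obtain ⟨φ, hφ, -⟩ := exists_hom X (-x + x')
      have h0 : φ ≫ f = 0 := by
        obtain ⟨ψ, -, hψ⟩ := exists_hom Y 0
        rw [hψ 0 rfl]
        refine hψ _ ?_
        change f.f (φ.f _) = 0
        rw [hφ, map_add, map_neg', hx, neg_add_cancel]
      have h1 : φ ≫ g = 0 := by
        rw [← kernel.lift_ι f φ h0, Category.assoc, hg, comp_zero]
      have h2 : g.f (-x + x') = 0 := by
        rw [← hφ]
        exact types_congr_hom (congrArg Monad.Algebra.Hom.f h1) _
      rw [map_add, map_neg'] at h2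
      exact neg_add_eq_zero.1 h2
    exact CokernelCofork.IsColimit.ofπ _ _
      (fun g hg => descOfSurjective _ hf g (hd g hg))
      (fun g hg => comp_descOfSurjective _ _ _ _)
      (fun g hg m hm => by
        rw [← cancel_epi f, hm, comp_descOfSurjective])

noncomputable instance abelian : Abelian (Tilted T) where

section Coproducts

/-- The morphism from a free module determined by the images of the generators. -/
noncomputable def freeDesc {Y : Type v} {X : Tilted T} (φ : Y → X.A) :
    (tiltingMonad T).free.obj Y ⟶ X :=
  ((tiltingMonad T).adj.homEquiv _ _).symm (↾φ)

lemma freeDesc_ι {Y : Type v} {X : Tilted T} (φ : Y → X.A) (y : Y) :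
    (freeDesc φ).f (Sigma.ι (fun _ : Y => T) y) = φ y :=
  types_congr_hom (((tiltingMonad T).adj.homEquiv _ _).apply_symm_apply (↾φ)) y

lemma free_hom_ext {Y : Type v} {X : Tilted T} {f g : (tiltingMonad T).free.obj Y ⟶ X}
    (h : ∀ y, f.f (Sigma.ι (fun _ : Y => T) y) = g.f (Sigma.ι (fun _ : Y => T) y)) : f = g := by
  apply ((tiltingMonad T).adj.homEquiv _ _).injective
  ext y
  exact h y

lemma map_free {Y : Type v} {X : Tilted T} (f : (tiltingMonad T).free.obj Y ⟶ X)
    {Z : Type v} (g : T ⟶ ∐ fun _ : Z => T) (a : Z → (T ⟶ ∐ fun _ : Y => T)) :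
    f.f (g ≫ Sigma.desc a) =
      X.act (g ≫ Sigma.desc fun z => Sigma.ι (fun _ : X.A => T) (f.f (a z))) := by
  let F : Tilted T := (tiltingMonad T).free.obj Y
  have h : (g ≫ Sigma.desc a : T ⟶ ∐ fun _ : Y => T) =
      F.act (g ≫ Sigma.desc fun z => Sigma.ι (fun _ : F.A => T) (a z)) := by
    change _ = (g ≫ Sigma.desc fun z => Sigma.ι (fun _ : (T ⟶ ∐ fun _ : Y => T) => T) (a z)) ≫
      Sigma.desc id
    rw [Category.assoc]
    congr 1
    ext z
    simp
  refine (congrArg (fun t => f.f t) h).trans ?_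
  rw [map_act (X := F), Category.assoc]
  congr 2
  ext z
  simp

variable {J : Type v} (X : J → Tilted T)

/-- The relations expressing the operations of the given modules. -/
noncomputable def coprodRel :
    (tiltingMonad T).free.obj (Σ j, (T ⟶ ∐ fun _ : (X j).A => T)) ⟶
      (tiltingMonad T).free.obj (Σ j, (X j).A) :=
  freeDesc fun p =>
    -(show ((tiltingMonad T).free.obj (Σ j, (X j).A)).A from
        Sigma.ι (fun _ : (Σ j, (X j).A) => T) ⟨p.1, (X p.1).act p.2⟩) +
      (show ((tiltingMonad T).free.obj (Σ j, (X j).A)).A from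
        p.2 ≫ Sigma.desc fun x => Sigma.ι (fun _ : (Σ j, (X j).A) => T) ⟨p.1, x⟩)

/-- The inclusion into the coproduct. -/
noncomputable def coprodι (j : J) : X j ⟶ coker (coprodRel X) :=
  homMk (fun x => (cokerπ (coprodRel X)).f (Sigma.ι (fun _ : (Σ j, (X j).A) => T) ⟨j, x⟩))
    fun g => by
      refine Eq.trans ?_ (map_free (cokerπ (coprodRel X)) g
        fun x => Sigma.ι (fun _ : (Σ j, (X j).A) => T) ⟨j, x⟩)
      exact (cokerπ_eq_iff _ _ _).2
        ⟨Sigma.ι (fun _ : (Σ j, (T ⟶ ∐ fun _ : (X j).A => T)) => T) ⟨j, g⟩, freeDesc_ι _ _⟩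

/-- The coproduct as a cokernel of free modules. -/
noncomputable def coprodIsColimit : IsColimit (Cofan.mk _ (coprodι X)) := by
  have hd : ∀ {Z : Tilted T} (k : ∀ j, X j ⟶ Z), coprodRel X ≫
      freeDesc (fun p : (Σ j, (X j).A) => (k p.1).f p.2) = 0 := fun {Z} k => by
    refine free_hom_ext fun p => ?_
    change (freeDesc _).f ((coprodRel X).f _) = 0
    rw [coprodRel, freeDesc_ι, map_add, map_neg']
    refine neg_add_eq_zero.2 ?_
    refine (freeDesc_ι _ _).trans ?_
    refine Eq.trans ?_ (map_free _ p.2 _).symm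
    rw [map_act]
    congr 2
    ext x
    simp only [Sigma.ι_desc]
    rw [freeDesc_ι]
  refine Cofan.IsColimit.mk _ (fun s => cokerDesc _ _ (hd s.inj)) (fun s j => ?_)
    (fun s m hm => ?_)
  · refine hom_ext fun x => ?_
    refine Eq.trans ?_ (freeDesc_ι (fun p : (Σ j, (X j).A) => (s.inj p.1).f p.2) ⟨j, x⟩)
    exact types_congr_hom (congrArg Monad.Algebra.Hom.f (cokerπ_desc _ _ (hd s.inj))) _
  · rw [← cancel_epi (cokerπ (coprodRel X)), cokerπ_desc]
    refine free_hom_ext fun p => ?_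
    rw [freeDesc_ι]
    exact types_congr_hom (congrArg Monad.Algebra.Hom.f (hm p.1)) p.2

instance (T : A) : HasColimits (Tilted T) := by
  have : HasCoproducts.{v} (Tilted T) := fun J =>
    { has_colimit := fun F =>
        have : HasColimit (Discrete.functor (F.obj ∘ Discrete.mk)) :=
          ⟨⟨⟨_, coprodIsColimit fun j => F.obj ⟨j⟩⟩⟩⟩
        hasColimit_of_iso (Discrete.natIsoFunctor (F := F)) }
  have : HasCoequalizers (Tilted T) := Preadditive.hasCoequalizers_of_hasCokernels
  exact has_colimits_of_hasCoequalizers_and_coproducts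

end Coproducts

end Tilted

end Preadditive

section Functors

variable {A : Type u} [Category.{v} A] [HasCoproducts.{v} A] [HasCoequalizers A]

/-- The functor `Ψ : A ⥤ σ_T(A)` sending `N` to the set `Hom(T, N)` with its natural structure of
a module over the monad. -/
noncomputable abbrev Tilted.Ψ (T : A) : A ⥤ Tilted T :=
  Monad.comparison (sigmaConstAdj.{v} T)

/-- The functor `Φ : σ_T(A) ⥤ A`, left adjoint to `Ψ`. -/
noncomputable abbrev Tilted.Φ (T : A) : Tilted T ⥤ A :=
  Monad.MonadicityInternal.leftAdjointComparison (sigmaConstAdj.{v} T)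

/-- The adjunction `Φ ⊣ Ψ`. -/
noncomputable abbrev Tilted.adjunction (T : A) : Tilted.Φ T ⊣ Tilted.Ψ T :=
  Monad.MonadicityInternal.comparisonAdjunction (sigmaConstAdj.{v} T)

end Functors

section Cotilted

variable {B : Type u} [Category.{v} B] [HasProducts.{v} B] [HasEqualizers B]

/-- The abelian category `π_W(B)`, dual to `σ_T(A)`: the opposite category to the category of
modules over the monad `X ↦ Hom(W^X, W)` on the category of sets. -/
abbrev Cotilted (W : B) : Type (v + 1) := (Tilted (op W))ᵒᵖ

/-- The functor `Φ : B ⥤ π_W(B)` sending `N` to the set `Hom(N, W)` with its natural structure of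
a module over the monad. -/
noncomputable abbrev Cotilted.Φ (W : B) : B ⥤ Cotilted W :=
  (Tilted.Ψ (op W)).rightOp

/-- The functor `Ψ : π_W(B) ⥤ B`, right adjoint to `Φ`. -/
noncomputable abbrev Cotilted.Ψ (W : B) : Cotilted W ⥤ B :=
  (Tilted.Φ (op W)).leftOp

/-- The adjunction `Φ ⊣ Ψ`. -/
noncomputable abbrev Cotilted.adjunction (W : B) : Cotilted.Φ W ⊣ Cotilted.Ψ W :=
  Adjunction.leftOp (F := Tilted.Φ (op W)) (G := (Tilted.Ψ (op W)).rightOp)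
    (Tilted.adjunction (op W))

end Cotilted

section Classes

variable {C : Type u} [Category.{v} C]

/-- `Add(T)`: the direct summands of coproducts of copies of `T`. -/
def addClosure [HasCoproducts.{v} C] (T : C) : ObjectProperty C :=
  fun M => ∃ X : Type v, Nonempty (Retract M (∐ fun _ : X => T))

/-- `Prod(W)`: the direct summands of products of copies of `W`. -/
def prodClosure [HasProducts.{v} C] (W : C) : ObjectProperty C :=
  fun M => ∃ X : Type v, Nonempty (Retract M (∏ᶜ fun _ : X => W))

variable [Abelian C]

/-- `Ext^i(X, Y) = 0` for all `i > 0`. -/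
def ExtVanishes (X Y : C) : Prop :=
  letI := HasExt.standard C
  ∀ i : ℕ, 0 < i → Subsingleton (Abelian.Ext.{max u v} X Y i)

/-- Weakly tilting objects: `Ext^i(T, T^(X)) = 0` for all sets `X` and all `i > 0`. -/
def IsWeaklyTilting [HasCoproducts.{v} C] (T : C) : Prop :=
  ∀ X : Type v, ExtVanishes T (∐ fun _ : X => T)

/-- Weakly cotilting objects: `Ext^i(W^X, W) = 0` for all sets `X` and all `i > 0`. -/
def IsWeaklyCotilting [HasProducts.{v} C] (W : C) : Prop :=
  ∀ X : Type v, ExtVanishes (∏ᶜ fun _ : X => W) W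

/-- The class `E_max(T)`. The second condition asks for an exact complex
`⋯ ⟶ T₁ ⟶ T₀ ⟶ E ⟶ 0` with `T_j` in `Add(T)`, which remains exact after applying `Hom(T, -)`;
here `E` is placed in degree `0` and `T_j` in degree `j + 1`. -/
def Emax [HasCoproducts.{v} C] (T : C) : ObjectProperty C := fun E =>
  ExtVanishes T E ∧
  ∃ K : ChainComplex C ℕ, Nonempty (K.X 0 ≅ E) ∧ (∀ j, addClosure T (K.X (j + 1))) ∧
    K.Acyclic ∧
    (((preadditiveCoyoneda.obj (op T)).mapHomologicalComplex (ComplexShape.down ℕ)).obj K).Acyclic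

/-- The class `F_max(W)`. The second condition asks for an exact complex
`0 ⟶ F ⟶ W⁰ ⟶ W¹ ⟶ ⋯` with `W^j` in `Prod(W)`, which remains exact after applying the
contravariant functor `Hom(-, W)`; here `F` is placed in degree `0` and `W^j` in degree `j + 1`. -/
def Fmax [HasProducts.{v} C] (W : C) : ObjectProperty C := fun F =>
  ExtVanishes F W ∧
  ∃ K : CochainComplex C ℕ, Nonempty (K.X 0 ≅ F) ∧ (∀ j, prodClosure W (K.X (j + 1))) ∧
    K.Acyclic ∧
    (((preadditiveYoneda.obj W).mapHomologicalComplex (ComplexShape.up ℕ).symm).obj K.op).Acyclic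

/-- `∞`-tilting objects (in a category with products and an injective cogenerator): weakly tilting
objects `T` such that all injective objects belong to `E_max(T)`. -/
def IsInfinityTilting [HasCoproducts.{v} C] (T : C) : Prop :=
  IsWeaklyTilting T ∧ ∀ I : C, Injective I → Emax T I

/-- `∞`-cotilting objects (in a category with coproducts and a projective generator): weakly
cotilting objects `W` such that all projective objects belong to `F_max(W)`. -/
def IsInfinityCotilting [HasProducts.{v} C] (W : C) : Prop :=
  IsWeaklyCotilting W ∧ ∀ P : C, Projective P → Fmax W P

end Classes

section Equivalences

variable {A : Type*} [Category A] {B : Type*} [Category B] {Φ : B ⥤ A} {Ψ : A ⥤ B}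

/-- The functors of an adjunction `Φ ⊣ Ψ` restrict to mutually inverse equivalences between the
full subcategories `E` and `F`, the natural isomorphisms being the unit and the counit. -/
structure RestrictsToEquivalence (adj : Φ ⊣ Ψ) (E : ObjectProperty A) (F : ObjectProperty B) :
    Prop where
  map_right : ∀ X, E X → F (Ψ.obj X)
  map_left : ∀ Y, F Y → E (Φ.obj Y)
  isIso_counit : ∀ X, E X → IsIso (adj.counit.app X)
  isIso_unit : ∀ Y, F Y → IsIso (adj.unit.app Y)

/-- The resulting equivalence between the full subcategories. -/
noncomputable def RestrictsToEquivalence.equivalence {adj : Φ ⊣ Ψ} {E : ObjectProperty A}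
    {F : ObjectProperty B} (h : RestrictsToEquivalence adj E F) :
    E.FullSubcategory ≌ F.FullSubcategory :=
  CategoryTheory.Equivalence.mk
    (F.lift (E.ι ⋙ Ψ) fun X => h.map_right _ X.property)
    (E.lift (F.ι ⋙ Φ) fun Y => h.map_left _ Y.property)
    (NatIso.ofComponents (F := F.lift (E.ι ⋙ Ψ) (fun X => h.map_right _ X.property) ⋙
        E.lift (F.ι ⋙ Φ) fun Y => h.map_left _ Y.property) (G := 𝟭 _)
      (fun X =>
        haveI := h.isIso_counit _ X.property
        E.isoMk (asIso (adj.counit.app X.obj)))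
      fun f => ObjectProperty.hom_ext _ (adj.counit.naturality f.hom)).symm
    (NatIso.ofComponents (F := 𝟭 _) (G := E.lift (F.ι ⋙ Φ) (fun Y => h.map_left _ Y.property) ⋙
        F.lift (E.ι ⋙ Ψ) fun X => h.map_right _ X.property)
      (fun Y =>
        haveI := h.isIso_unit _ Y.property
        F.isoMk (asIso (adj.unit.app Y.obj)))
      fun f => ObjectProperty.hom_ext _ (adj.unit.naturality f.hom)).symm

/-- The functors of an adjunction `Φ ⊣ Ψ` restrict to mutually inverse equivalences of exact
categories between the full subcategories `E` and `F`. Both subcategories are closed under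
extensions and carry the inherited exact structures, whose admissible short exact sequences are the
short exact sequences of the ambient abelian category with all three terms in the subcategory. -/
structure RestrictsToExactEquivalence [Abelian A] [Abelian B] [Φ.PreservesZeroMorphisms]
    [Ψ.PreservesZeroMorphisms] (adj : Φ ⊣ Ψ) (E : ObjectProperty A) (F : ObjectProperty B) :
    Prop extends RestrictsToEquivalence adj E F where
  isClosedUnderExtensions_right : E.IsClosedUnderExtensions
  isClosedUnderExtensions_left : F.IsClosedUnderExtensions
  exact_right : ∀ S : ShortComplex A, E S.X₁ → E S.X₂ → E S.X₃ → S.ShortExact →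
    (S.map Ψ).ShortExact
  exact_left : ∀ S : ShortComplex B, F S.X₁ → F S.X₂ → F S.X₃ → S.ShortExact →
    (S.map Φ).ShortExact

end Equivalences

section Additivity

variable {C : Type u} [Category.{v} C] [Abelian C]

instance [HasCoproducts.{v} C] (T : C) : (Tilted.Ψ T).PreservesZeroMorphisms :=
  have := (Tilted.adjunction T).isRightAdjoint
  inferInstance

instance [HasCoproducts.{v} C] (T : C) : (Tilted.Φ T).PreservesZeroMorphisms :=
  have := (Tilted.adjunction T).isLeftAdjoint
  inferInstance

instance [HasProducts.{v} C] (W : C) : (Cotilted.Ψ W).PreservesZeroMorphisms :=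
  have := (Cotilted.adjunction W).isRightAdjoint
  inferInstance

instance [HasProducts.{v} C] (W : C) : (Cotilted.Φ W).PreservesZeroMorphisms :=
  have := (Cotilted.adjunction W).isLeftAdjoint
  inferInstance

end Additivity

end TiltingTheory

/-! The engine is a coinductive description of $E_{\max}(T)$: it is the largest class of objects $E$
with $\mathrm{Ext}^{>0}(T,E)=0$ that are quotients of objects of $\mathrm{Add}(T)$ with kernel again
in the class (`IsResolving.emax`, `isResolving_emax`). Membership is proved by exhibiting such a
class, and infinite resolutions are handled one short exact sequence at a time. Closure under
extensions (`Emax.extension`) and under cokernels of monomorphisms (`Emax.quotient`) follows.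

Tilting half. $\Psi(T^{(X)})$ is the free module on $X$, so the counit is invertible on
$\mathrm{Add}(T)$, which corresponds to the projective modules. $\Psi$ is exact on short exact
sequences starting in $E_{\max}(T)$, because $\mathrm{Ext}^1(T,-)$ vanishes there; a five-lemma
argument on an $\mathrm{Add}(T)$-presentation makes the counit invertible on $E_{\max}(T)$
(`isIso_counit_of_emax`). Applying $\Psi$ to an $\mathrm{Add}(T)$-resolution of $E$ gives a
projective resolution of $\Psi E$, whence $\mathrm{Ext}^{>0}(\Psi E,W)=0$. Embedding $E$ into a
power of $J$, which lies in $E_{\max}(T)$ by the tilting hypothesis, and iterating on the cokernel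
gives $\Psi E\in F_{\max}(W)$ (`fmax_Ψ`). Backwards, $\mathrm{Hom}(\Phi -,J)=\mathrm{Hom}(-,W)$ and
$J$ cogenerates, so $\Phi$ is exact on short exact sequences ending in $F_{\max}(W)$; the mirrored
arguments give invertible units and $\Phi F\in E_{\max}(T)$ (`isIso_unit_of_fmax`, `emax_Φ`).

Cotilting half. It is the tilting half for the opposite category. The one point that is not formal
is that vanishing of Ext is self-dual (`extVanishes_op_iff`). -/

namespace TiltingTheory

open scoped ZeroObject

/-! ### Vanishing of Ext: dimension shifting and duality. -/

section Ext

open Abelian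

variable {D : Type u} [Category.{v} D] [Abelian D]

attribute [local instance] HasExt.standard

lemma extVanishes_iff (X Y : D) :
    ExtVanishes X Y ↔ ∀ (n : ℕ) (e : Ext.{max u v} X Y (n + 1)), e = 0 := by
  constructor
  · intro h n e
    have := h (n + 1) (Nat.succ_pos n)
    exact Subsingleton.elim _ _
  · intro h i hi
    obtain ⟨n, rfl⟩ : ∃ n, i = n + 1 := ⟨i - 1, by omega⟩
    exact subsingleton_of_forall_eq 0 (h n)

lemma ExtVanishes.of_retract_left {X X' Y : D} (r : Retract X X') (h : ExtVanishes X' Y) :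
    ExtVanishes X Y := by
  rw [extVanishes_iff] at h ⊢
  intro n e
  have : e = (Ext.mk₀ r.i).comp ((Ext.mk₀ r.r).comp e (zero_add _)) (zero_add _) := by
    rw [Ext.mk₀_comp_mk₀_assoc, r.retract, Ext.mk₀_id_comp]
  rw [this, h n ((Ext.mk₀ r.r).comp e (zero_add _)), Ext.comp_zero]

lemma ExtVanishes.of_retract_right {X Y Y' : D} (r : Retract Y Y') (h : ExtVanishes X Y') :
    ExtVanishes X Y := by
  rw [extVanishes_iff] at h ⊢
  intro n e
  have : e = (e.comp (Ext.mk₀ r.i) (add_zero _)).comp (Ext.mk₀ r.r) (add_zero _) := by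
    rw [Ext.comp_assoc_of_third_deg_zero, Ext.mk₀_comp_mk₀, r.retract, Ext.comp_mk₀_id]
  rw [this, h n (e.comp (Ext.mk₀ r.i) (add_zero _)), Ext.zero_comp]

lemma extVanishes_of_injective (X I : D) [Injective I] : ExtVanishes X I :=
  (extVanishes_iff X I).2 fun _ e => Ext.eq_zero_of_injective e

lemma extVanishes_of_projective (P Y : D) [Projective P] : ExtVanishes P Y :=
  (extVanishes_iff P Y).2 fun _ e => Ext.eq_zero_of_projective e

variable {S : ShortComplex D} (hS : S.ShortExact)

include hS

lemma ExtVanishes.middle {X : D} (h₁ : ExtVanishes X S.X₁) (h₃ : ExtVanishes X S.X₃) :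
    ExtVanishes X S.X₂ := by
  rw [extVanishes_iff] at h₁ h₃ ⊢
  intro n e
  obtain ⟨e₁, rfl⟩ := Ext.covariant_sequence_exact₂ X hS e (h₃ n _)
  rw [h₁ n e₁, Ext.zero_comp]

lemma ExtVanishes.quotient {X : D} (h₁ : ExtVanishes X S.X₁) (h₂ : ExtVanishes X S.X₂) :
    ExtVanishes X S.X₃ := by
  rw [extVanishes_iff] at h₁ h₂ ⊢
  intro n e
  obtain ⟨e₂, rfl⟩ := Ext.covariant_sequence_exact₃ X hS e rfl (h₁ (n + 1) _)
  rw [h₂ n e₂, Ext.zero_comp]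

/-- The lifting hypothesis serves only in degree 1, where it kills the connecting map; higher
degrees come from `h₃` by dimension shifting. -/
lemma ExtVanishes.sub {X : D} (h₂ : ExtVanishes X S.X₂) (h₃ : ExtVanishes X S.X₃)
    (hs : ∀ f : X ⟶ S.X₃, ∃ g : X ⟶ S.X₂, g ≫ S.g = f) : ExtVanishes X S.X₁ := by
  rw [extVanishes_iff] at h₂ h₃ ⊢
  intro n e
  obtain ⟨e₃, rfl⟩ := Ext.covariant_sequence_exact₁ X hS e (h₂ n _) rfl
  cases n with
  | zero =>
    obtain ⟨f, rfl⟩ := (Ext.addEquiv₀ (X := X) (Y := S.X₃)).symm.surjective e₃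
    obtain ⟨g, rfl⟩ := hs f
    rw [Ext.addEquiv₀_symm_apply, ← Ext.mk₀_comp_mk₀, Ext.comp_assoc_of_second_deg_zero, hS.comp_extClass, Ext.comp_zero]
  | succ n => rw [h₃ n e₃, Ext.zero_comp]

lemma ExtVanishes.exists_lift {X : D} (h₁ : ExtVanishes X S.X₁) (f : X ⟶ S.X₃) :
    ∃ g : X ⟶ S.X₂, g ≫ S.g = f := by
  rw [extVanishes_iff] at h₁
  obtain ⟨x, hx⟩ := Ext.covariant_sequence_exact₃ X hS (Ext.mk₀ f) rfl (h₁ 0 _)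
  obtain ⟨g, rfl⟩ := (Ext.addEquiv₀ (X := X) (Y := S.X₂)).symm.surjective x
  refine ⟨g, Ext.addEquiv₀.symm.injective ?_⟩
  simpa using hx

lemma ExtVanishes.sub_left {Y : D} (h₂ : ExtVanishes S.X₂ Y) (h₃ : ExtVanishes S.X₃ Y) :
    ExtVanishes S.X₁ Y := by
  rw [extVanishes_iff] at h₂ h₃ ⊢
  intro n e
  obtain ⟨e₂, rfl⟩ := Ext.contravariant_sequence_exact₁ hS Y e (add_comm _ _) (h₃ (n + 1) _)
  rw [h₂ n e₂, Ext.comp_zero]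

lemma ExtVanishes.exists_desc {Y : D} (h₃ : ExtVanishes S.X₃ Y) (f : S.X₁ ⟶ Y) :
    ∃ g : S.X₂ ⟶ Y, S.f ≫ g = f := by
  rw [extVanishes_iff] at h₃
  obtain ⟨x, hx⟩ := Ext.contravariant_sequence_exact₁ hS Y (Ext.mk₀ f) rfl (h₃ 0 _)
  obtain ⟨g, rfl⟩ := (Ext.addEquiv₀ (X := S.X₂) (Y := Y)).symm.surjective x
  refine ⟨g, Ext.addEquiv₀.symm.injective ?_⟩
  simpa using hx

omit hS in
/-- Dimension shifting along syzygies that stay in a class `R`. -/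
lemma extVanishes_of_syzygies (R : ObjectProperty D) (Y : D)
    (h : ∀ X, R X → ∃ S : ShortComplex D, S.ShortExact ∧ S.X₃ = X ∧ R S.X₁ ∧ Projective S.X₂ ∧
      ∀ f : S.X₁ ⟶ Y, ∃ g : S.X₂ ⟶ Y, S.f ≫ g = f) {X : D} (hX : R X) : ExtVanishes X Y := by
  rw [extVanishes_iff]
  intro n
  induction n generalizing X with
  | zero =>
    obtain ⟨S, hS, rfl, -, hP, hs⟩ := h X hX
    intro e
    obtain ⟨x, rfl⟩ := Ext.contravariant_sequence_exact₃ hS Y e (Ext.eq_zero_of_projective _)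
      (add_comm 1 0)
    obtain ⟨f, rfl⟩ := (Ext.addEquiv₀ (X := S.X₁) (Y := Y)).symm.surjective x
    obtain ⟨g, rfl⟩ := hs f
    rw [Ext.addEquiv₀_symm_apply, ← Ext.mk₀_comp_mk₀,
      ← Ext.comp_assoc_of_second_deg_zero, hS.extClass_comp, Ext.zero_comp]
  | succ n ih =>
    obtain ⟨S, hS, rfl, hR, hP, -⟩ := h X hX
    intro e
    obtain ⟨x, rfl⟩ := Ext.contravariant_sequence_exact₃ hS Y e (Ext.eq_zero_of_projective _)
      (add_comm 1 (n + 1))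
    rw [ih hR x, Ext.comp_zero]

omit hS in
/-- Dimension shifting along cosyzygies that stay in a class `R`. -/
lemma extVanishes_of_cosyzygies (R : ObjectProperty D) (X : D)
    (h : ∀ Y, R Y → ∃ S : ShortComplex D, S.ShortExact ∧ S.X₁ = Y ∧ R S.X₃ ∧ Injective S.X₂ ∧
      ∀ f : X ⟶ S.X₃, ∃ g : X ⟶ S.X₂, g ≫ S.g = f) {Y : D} (hY : R Y) : ExtVanishes X Y := by
  rw [extVanishes_iff]
  intro n
  induction n generalizing Y with
  | zero =>
    obtain ⟨S, hS, rfl, -, hP, hs⟩ := h Y hY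
    intro e
    obtain ⟨x, rfl⟩ := Ext.covariant_sequence_exact₁ X hS e (Ext.eq_zero_of_injective _) rfl
    obtain ⟨f, rfl⟩ := (Ext.addEquiv₀ (X := X) (Y := S.X₃)).symm.surjective x
    obtain ⟨g, rfl⟩ := hs f
    rw [Ext.addEquiv₀_symm_apply, ← Ext.mk₀_comp_mk₀, Ext.comp_assoc_of_second_deg_zero,
      hS.comp_extClass, Ext.comp_zero]
  | succ n ih =>
    obtain ⟨S, hS, rfl, hR, hP, -⟩ := h Y hY
    intro e
    obtain ⟨x, rfl⟩ := Ext.covariant_sequence_exact₁ X hS e (Ext.eq_zero_of_injective _) rfl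
    rw [ih hR x, Ext.zero_comp]

omit hS

/-- A short exact sequence ending in `X` whose middle term is projective. -/
lemma exists_syzygy [EnoughProjectives D] (X : D) :
    ∃ S : ShortComplex D, S.ShortExact ∧ S.X₃ = X ∧ Projective S.X₂ :=
  ⟨ShortComplex.mk _ _ (kernel.condition (Projective.π X)),
    { exact := ShortComplex.exact_of_f_is_kernel _ (kernelIsKernel _)
      mono_f := by dsimp; infer_instance
      epi_g := by dsimp; infer_instance }, rfl, by dsimp; infer_instance⟩

/-- A short exact sequence starting in `X` whose middle term is injective. -/
lemma exists_cosyzygy [EnoughInjectives D] (X : D) :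
    ∃ S : ShortComplex D, S.ShortExact ∧ S.X₁ = X ∧ Injective S.X₂ :=
  ⟨ShortComplex.mk _ _ (cokernel.condition (Injective.ι X)),
    { exact := ShortComplex.exact_of_g_is_cokernel _ (cokernelIsCokernel _)
      mono_f := by dsimp; infer_instance
      epi_g := by dsimp; infer_instance }, rfl, by dsimp; infer_instance⟩

/-- Ext groups of `D` and `Dᵒᵖ` are not compared, only their vanishing. Projective presentations in
`D` become injective copresentations in `Dᵒᵖ`, and either vanishing condition passes to syzygies and
extends morphisms along them, so dimension shifting yields the other one. -/
lemma extVanishes_op_iff [EnoughProjectives D] (X Y : D) :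
    ExtVanishes (op Y) (op X) ↔ ExtVanishes X Y := by
  constructor
  · intro h
    refine extVanishes_of_syzygies (fun X => ExtVanishes (op Y) (op X)) Y (fun X hX => ?_) h
    obtain ⟨S, hS, rfl, hP⟩ := exists_syzygy X
    have hs : ∀ f : S.X₁ ⟶ Y, ∃ g : S.X₂ ⟶ Y, S.f ≫ g = f := fun f => by
      obtain ⟨g, hg⟩ := hX.exists_lift hS.op f.op
      exact ⟨g.unop, Quiver.Hom.op_inj hg⟩
    exact ⟨S, hS, rfl, ExtVanishes.quotient hS.op hX
      (have : Injective (op S.X₂) := inferInstance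
       extVanishes_of_injective (op Y) (op S.X₂)), hP, hs⟩
  · intro h
    refine extVanishes_of_cosyzygies (fun Z => ExtVanishes Z.unop Y) (op Y) (fun Z hZ => ?_) h
    obtain ⟨S, hS, hZ', hP⟩ := exists_syzygy Z.unop
    rw [← hZ'] at hZ
    refine ⟨S.op, hS.op, congrArg op hZ', ExtVanishes.sub_left hS
      (extVanishes_of_projective _ _) hZ, ?_, fun f => ?_⟩
    · exact (inferInstance : Injective (op S.X₂))
    · obtain ⟨g, hg⟩ := hZ.exists_desc hS f.unop
      exact ⟨g.op, Quiver.Hom.unop_inj hg⟩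

end Ext

/-! ### Splicing short exact sequences into a resolution. -/

section Splice

variable {C : Type u} [Category.{v} C] [Abelian C]

/-- The objects of the complex spliced from short exact sequences `0 ⟶ Zₙ₊₁ ⟶ Yₙ ⟶ Zₙ ⟶ 0`. -/
def spliceX (Z Y : ℕ → C) : ℕ → C
  | 0 => Z 0
  | n + 1 => Y n

/-- The differentials of the spliced complex. -/
def spliceD {Z Y : ℕ → C} (i : ∀ n, Z (n + 1) ⟶ Y n) (p : ∀ n, Y n ⟶ Z n) :
    ∀ n, spliceX Z Y (n + 1) ⟶ spliceX Z Y n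
  | 0 => p 0
  | n + 1 => p (n + 1) ≫ i n

variable {Z Y : ℕ → C} {i : ∀ n, Z (n + 1) ⟶ Y n} {p : ∀ n, Y n ⟶ Z n} (w : ∀ n, i n ≫ p n = 0)

include w in
lemma spliceD_comp (n : ℕ) : spliceD i p (n + 1) ≫ spliceD i p n = 0 := by
  cases n with
  | zero =>
    change (p 1 ≫ i 0) ≫ p 0 = 0
    rw [Category.assoc, w, comp_zero]
  | succ n =>
    change (p (n + 2) ≫ i (n + 1)) ≫ p (n + 1) ≫ i n = 0
    rw [Category.assoc, reassoc_of% (w (n + 1)), zero_comp, comp_zero]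

/-- The complex spliced from short exact sequences `0 ⟶ Zₙ₊₁ ⟶ Yₙ ⟶ Zₙ ⟶ 0`. -/
def splice : ChainComplex C ℕ :=
  ChainComplex.of (spliceX Z Y) (spliceD i p) (spliceD_comp w)

lemma splice_d (n : ℕ) : (splice w).d (n + 1) n = spliceD i p n :=
  ChainComplex.of_d _ _ _

lemma chainComplex_exactAt_zero_iff (K : ChainComplex C ℕ) : K.ExactAt 0 ↔ Epi (K.d 1 0) := by
  rw [K.exactAt_iff' 1 0 0 (by simp) (by simp)]
  exact ShortComplex.exact_iff_epi _ (K.shape _ _ (by simp))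

lemma chainComplex_exactAt_succ_iff (K : ChainComplex C ℕ) (n : ℕ) :
    K.ExactAt (n + 1) ↔ (K.sc' (n + 2) (n + 1) n).Exact :=
  K.exactAt_iff' (n + 2) (n + 1) n (by simp) (by simp)

/-- The complex `Hom(T, K)` is acyclic iff cycles lift. -/
lemma homComplex_acyclic_iff (T : C) (K : ChainComplex C ℕ) :
    (((preadditiveCoyoneda.obj (op T)).mapHomologicalComplex (ComplexShape.down ℕ)).obj K).Acyclic
      ↔ (∀ f : T ⟶ K.X 0, ∃ g : T ⟶ K.X 1, g ≫ K.d 1 0 = f) ∧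
        ∀ (n : ℕ) (f : T ⟶ K.X (n + 1)), f ≫ K.d (n + 1) n = 0 →
          ∃ g : T ⟶ K.X (n + 2), g ≫ K.d (n + 2) (n + 1) = f := by
  have h0 := chainComplex_exactAt_zero_iff
    (((preadditiveCoyoneda.obj (op T)).mapHomologicalComplex (ComplexShape.down ℕ)).obj K)
  rw [AddCommGrpCat.epi_iff_surjective] at h0
  have h1 := fun n => (chainComplex_exactAt_succ_iff
    (((preadditiveCoyoneda.obj (op T)).mapHomologicalComplex
      (ComplexShape.down ℕ)).obj K) n).trans (ShortComplex.ab_exact_iff _)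
  constructor
  · intro h
    exact ⟨h0.1 (h 0), fun n => (h1 n).1 (h (n + 1))⟩
  · rintro ⟨a, b⟩ (_ | n)
    · exact h0.2 a
    · exact (h1 n).2 (b n)

variable (hS : ∀ n, (ShortComplex.mk (i n) (p n) (w n)).ShortExact)

include hS in
lemma splice_acyclic : (splice w).Acyclic := by
  have hepi : ∀ n, Epi (p n) := fun n => (hS n).epi_g
  have hmono : ∀ n, Mono (i n) := fun n => (hS n).mono_f
  rintro (_ | n)
  · rw [chainComplex_exactAt_zero_iff, splice_d]
    exact hepi 0
  · rw [chainComplex_exactAt_succ_iff]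
    cases n with
    | zero =>
      -- Position 1 is separate: the outgoing differential is `p 0` itself, with no monomorphism
      -- after it.
      let φ : (splice w).sc' 2 1 0 ⟶ ShortComplex.mk (i 0) (p 0) (w 0) :=
        { τ₁ := p 1
          τ₂ := 𝟙 _
          τ₃ := 𝟙 _
          comm₁₂ := ((Category.comp_id _).trans (splice_d w 1)).symm
          comm₂₃ := ((Category.comp_id _).trans ((splice_d w 0).trans
            (Category.id_comp _).symm)).symm }
      have : Epi φ.τ₁ := hepi 1
      have : IsIso φ.τ₂ := inferInstanceAs (IsIso (𝟙 _))
      have : Mono φ.τ₃ := inferInstanceAs (Mono (𝟙 _))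
      exact (ShortComplex.exact_iff_of_epi_of_isIso_of_mono φ).2 (hS 0).exact
    | succ n =>
      -- `φ` strips the epimorphism `p (n + 2)` from the incoming differential, and `ψ` strips the
      -- monomorphism `i n` from the outgoing one; neither affects exactness in the middle.
      let S' : ShortComplex C := ShortComplex.mk (i (n + 1)) (p (n + 1) ≫ i n)
        (by rw [reassoc_of% (w (n + 1)), zero_comp])
      let φ : (splice w).sc' (n + 3) (n + 2) (n + 1) ⟶ S' :=
        { τ₁ := p (n + 2)
          τ₂ := 𝟙 _
          τ₃ := 𝟙 _
          comm₁₂ := ((Category.comp_id _).trans (splice_d w (n + 2))).symm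
          comm₂₃ := ((Category.comp_id _).trans ((splice_d w (n + 1)).trans
            (Category.id_comp _).symm)).symm }
      have : Epi φ.τ₁ := hepi (n + 2)
      have : IsIso φ.τ₂ := inferInstanceAs (IsIso (𝟙 _))
      have : Mono φ.τ₃ := inferInstanceAs (Mono (𝟙 _))
      refine (ShortComplex.exact_iff_of_epi_of_isIso_of_mono φ).2 ?_
      let ψ : ShortComplex.mk (i (n + 1)) (p (n + 1)) (w (n + 1)) ⟶ S' :=
        { τ₁ := 𝟙 _
          τ₂ := 𝟙 _
          τ₃ := i n }
      have : Epi ψ.τ₁ := inferInstanceAs (Epi (𝟙 _))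
      have : IsIso ψ.τ₂ := inferInstanceAs (IsIso (𝟙 _))
      have : Mono ψ.τ₃ := hmono n
      exact (ShortComplex.exact_iff_of_epi_of_isIso_of_mono ψ).1 (hS (n + 1)).exact

include hS in
lemma homComplex_splice_acyclic (T : C)
    (hT : ∀ n (f : T ⟶ Z n), ∃ g : T ⟶ Y n, g ≫ p n = f) :
    (((preadditiveCoyoneda.obj (op T)).mapHomologicalComplex
      (ComplexShape.down ℕ)).obj (splice w)).Acyclic := by
  have hmono : ∀ n, Mono (i n) := fun n => (hS n).mono_f
  rw [homComplex_acyclic_iff]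
  refine ⟨fun f => ?_, fun n f hf => ?_⟩
  · obtain ⟨g, hg⟩ := hT 0 f
    exact ⟨g, by rw [splice_d]; exact hg⟩
  -- A cycle is already killed by `p n`, so it factors through `Z (n + 1)`, where `hT` applies.
  · have hf' : (show T ⟶ Y n from f) ≫ p n = 0 := by
      rw [splice_d] at hf
      cases n with
      | zero => exact hf
      | succ n =>
        rw [← cancel_mono (i n), Category.assoc, zero_comp]
        exact hf
    obtain ⟨g, hg⟩ := hT (n + 1) ((hS n).exact.lift (show T ⟶ Y n from f) hf')
    refine ⟨g, ?_⟩
    rw [splice_d]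
    change g ≫ p (n + 1) ≫ i n = f
    rw [reassoc_of% hg]
    exact (hS n).exact.lift_f _ _

end Splice

/-! ### `E_max(T)` as the largest resolving class. -/

section Emax

variable {C : Type u} [Category.{v} C] [Abelian C] [HasCoproducts.{v} C] {T : C}

/-- A class of objects without higher extensions from `T`, each of which is the quotient of an
object of `Add(T)` by an object of the class. -/
def IsResolving (T : C) (R : ObjectProperty C) : Prop :=
  ∀ E, R E → ExtVanishes T E ∧ ∃ (K T₀ : C) (i : K ⟶ T₀) (p : T₀ ⟶ E) (w : i ≫ p = 0),
    (ShortComplex.mk i p w).ShortExact ∧ addClosure T T₀ ∧ R K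

/-- Coinduction principle: iterate the chosen presentations and splice. Exactness under `Hom(T, -)`
is automatic, since each kernel lies in `R` and so has no `Ext¹` from `T`. -/
lemma IsResolving.emax {R : ObjectProperty C} (hR : IsResolving T R) {E : C} (hE : R E) :
    Emax T E := by
  refine ⟨(hR E hE).1, ?_⟩
  choose K Y i p w hS hY hK using fun E : {E // R E} => (hR E.1 E.2).2
  let s : ℕ → {E // R E} := fun n => Nat.rec ⟨E, hE⟩ (fun _ F => ⟨K F, hK F⟩) n
  refine ⟨splice (Z := fun n => (s n).1) (Y := fun n => Y (s n)) (i := fun n => i (s n))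
    (p := fun n => p (s n)) (fun n => w (s n)), ⟨Iso.refl _⟩, fun n => hY (s n),
    splice_acyclic _ fun n => hS (s n), homComplex_splice_acyclic _ (fun n => hS (s n)) T ?_⟩
  intro n f
  exact ExtVanishes.exists_lift (hS (s n)) (hR (s (n + 1)).1 (s (n + 1)).2).1 f

lemma extVanishes_of_addClosure (hT : IsWeaklyTilting T) {M : C} (hM : addClosure T M) :
    ExtVanishes T M := by
  obtain ⟨X, ⟨r⟩⟩ := hM
  exact (hT X).of_retract_right r

/-- With `IsResolving.emax` this makes `E_max(T)` the largest resolving class. To avoid truncating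
and reindexing complexes, one works in the class `R` of all `K.X 0` and all kernels of differentials
of admissible complexes `K`: it contains `E_max(T)`, it is resolving, hence it is contained in
`E_max(T)`. -/
lemma isResolving_emax (hT : IsWeaklyTilting T) : IsResolving T (Emax T) := by
  have key : ∃ R, IsResolving T R ∧ ∀ E, Emax T E → R E := by
    refine ⟨fun E => ExtVanishes T E ∧ ((∃ (K : ChainComplex C ℕ),
      (∀ j, addClosure T (K.X (j + 1))) ∧ K.Acyclic ∧
      (((preadditiveCoyoneda.obj (op T)).mapHomologicalComplex
        (ComplexShape.down ℕ)).obj K).Acyclic ∧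
      (Nonempty (K.X 0 ≅ E) ∨ ∃ n, Nonempty (kernel (K.d (n + 1) n) ≅ E)))), ?_,
      fun E ⟨h1, K, e, hK, hK', hT⟩ => ⟨h1, K, hK, hK', hT, Or.inl e⟩⟩
    rintro E ⟨hE, K, hK, hK', hKT, h⟩
    refine ⟨hE, ?_⟩
    have hKT' := (homComplex_acyclic_iff T K).1 hKT
    -- Both kinds of members of `R` are covered by some `K.X (n + 1)` through a `p` with the same
    -- kernel as the differential, so one argument handles both.
    obtain ⟨n, p, hp, hpE, hl⟩ : ∃ (n : ℕ) (p : K.X (n + 1) ⟶ E), Epi p ∧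
        (∀ {Z : C} (g : Z ⟶ K.X (n + 1)), g ≫ p = 0 ↔ g ≫ K.d (n + 1) n = 0) ∧
        ∀ f : T ⟶ E, ∃ g : T ⟶ K.X (n + 1), g ≫ p = f := by
      obtain ⟨⟨e⟩⟩ | ⟨n, ⟨e⟩⟩ := h
      · have := (chainComplex_exactAt_zero_iff K).1 (hK' 0)
        refine ⟨0, K.d 1 0 ≫ e.hom, inferInstance, fun g => ?_, fun f => ?_⟩
        · rw [← Category.assoc, ← zero_comp (f := e.hom), cancel_mono]
        · obtain ⟨g, hg⟩ := hKT'.1 (f ≫ e.inv)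
          exact ⟨g, by rw [reassoc_of% hg, e.inv_hom_id, Category.comp_id]⟩
      · have hex := (chainComplex_exactAt_succ_iff K n).1 (hK' (n + 1))
        have hepi : Epi (kernel.lift (K.d (n + 1) n) (K.d (n + 2) (n + 1)) (by simp)) :=
          (ShortComplex.exact_iff_epi_kernel_lift _).1 hex
        refine ⟨n + 1, kernel.lift (K.d (n + 1) n) (K.d (n + 2) (n + 1)) (by simp) ≫ e.hom,
          inferInstance, fun g => ?_, fun f => ?_⟩
        · rw [← Category.assoc, ← zero_comp (f := e.hom), cancel_mono,
            ← cancel_mono (kernel.ι (K.d (n + 1) n))]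
          simp
        · obtain ⟨g, hg⟩ := hKT'.2 n (f ≫ e.inv ≫ kernel.ι _) (by simp)
          refine ⟨g, ?_⟩
          rw [← cancel_mono e.inv, ← cancel_mono (kernel.ι (K.d (n + 1) n))]
          simpa using hg
    have hS : (ShortComplex.mk (kernel.ι (K.d (n + 1) n)) p
        ((hpE _).2 (kernel.condition _))).ShortExact :=
      { exact := ShortComplex.exact_of_f_is_kernel _
          (KernelFork.IsLimit.ofι _ _
            (fun g hg => kernel.lift _ g ((hpE g).1 hg)) (fun g hg => kernel.lift_ι _ _ _)
            (fun g hg m hm => by rw [← cancel_mono (kernel.ι _), hm, kernel.lift_ι]))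
        mono_f := by dsimp; infer_instance
        epi_g := hp }
    exact ⟨_, _, _, _, _, hS, hK n, ExtVanishes.sub hS (extVanishes_of_addClosure hT (hK n)) hE hl,
      K, hK, hK', hKT, Or.inr ⟨n, ⟨Iso.refl _⟩⟩⟩
  obtain ⟨R, hR, hER⟩ := key
  intro E hE
  obtain ⟨K, T₀, i, p, w, hS, hadd, hK⟩ := (hR E (hER E hE)).2
  exact ⟨hE.1, K, T₀, i, p, w, hS, hadd, hR.emax hK⟩

end Emax

/-! ### Formal properties of `Add(T)`. -/

section AddClosure

variable {C : Type u} [Category.{v} C] [HasCoproducts.{v} C] {T : C}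

lemma addClosure_self (T : C) : addClosure T T :=
  ⟨PUnit, ⟨{ i := Sigma.ι (fun _ : PUnit => T) ⟨⟩, r := Sigma.desc fun _ => 𝟙 T }⟩⟩

lemma addClosure.of_retract {M N : C} (hN : addClosure T N) (r : Retract M N) :
    addClosure T M := by
  obtain ⟨X, ⟨s⟩⟩ := hN
  exact ⟨X, ⟨r.trans s⟩⟩

/-- Lifting along a morphism for `T` implies lifting for the objects of `Add(T)`. -/
lemma addClosure.exists_lift {M : C} (hM : addClosure T M) {E E' : C} (q : E ⟶ E')
    (h : ∀ f : T ⟶ E', ∃ g : T ⟶ E, g ≫ q = f) (f : M ⟶ E') : ∃ g : M ⟶ E, g ≫ q = f := by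
  obtain ⟨X, ⟨r⟩⟩ := hM
  choose g hg using fun x : X => h (Sigma.ι (fun _ : X => T) x ≫ r.r ≫ f)
  refine ⟨r.i ≫ Sigma.desc g, ?_⟩
  have : Sigma.desc g ≫ q = r.r ≫ f := by
    ext x
    simp [hg]
  rw [Category.assoc, this, r.retract_assoc]

lemma addClosure.biprod [Preadditive C] [HasBinaryBiproducts C] {M N : C} (hM : addClosure T M) (hN : addClosure T N) :
    addClosure T (M ⊞ N) := by
  obtain ⟨X, ⟨r⟩⟩ := hM
  obtain ⟨Y, ⟨s⟩⟩ := hN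
  refine ⟨X ⊕ Y, ⟨{
    i := biprod.desc (r.i ≫ Sigma.desc fun x => Sigma.ι (fun _ : X ⊕ Y => T) (Sum.inl x))
      (s.i ≫ Sigma.desc fun y => Sigma.ι (fun _ : X ⊕ Y => T) (Sum.inr y))
    r := Sigma.desc (Sum.rec (fun x => Sigma.ι (fun _ : X => T) x ≫ r.r ≫ biprod.inl)
      (fun y => Sigma.ι (fun _ : Y => T) y ≫ s.r ≫ biprod.inr))
    retract := ?_ }⟩⟩
  have h1 : (Sigma.desc fun x => Sigma.ι (fun _ : X ⊕ Y => T) (Sum.inl x)) ≫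
      Sigma.desc (Sum.rec (fun x => Sigma.ι (fun _ : X => T) x ≫ r.r ≫ biprod.inl)
        (fun y => Sigma.ι (fun _ : Y => T) y ≫ s.r ≫ biprod.inr)) =
      r.r ≫ (biprod.inl : M ⟶ M ⊞ N) := by
    ext <;> simp
  have h2 : (Sigma.desc fun y => Sigma.ι (fun _ : X ⊕ Y => T) (Sum.inr y)) ≫
      Sigma.desc (Sum.rec (fun x => Sigma.ι (fun _ : X => T) x ≫ r.r ≫ biprod.inl)
        (fun y => Sigma.ι (fun _ : Y => T) y ≫ s.r ≫ biprod.inr)) =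
      s.r ≫ (biprod.inr : N ⟶ M ⊞ N) := by
    ext <;> simp
  apply biprod.hom_ext'
  · rw [biprod.inl_desc_assoc, Category.assoc, h1, Category.comp_id, r.retract_assoc]
  · rw [biprod.inr_desc_assoc, Category.assoc, h2, Category.comp_id, s.retract_assoc]

end AddClosure

/-! ### Closure of `E_max(T)` under extensions and cokernels. -/

section Emax

variable {C : Type u} [Category.{v} C] [Abelian C] 

/-- The kernel of a composition of epimorphisms is an extension of the kernels. -/
lemma exists_shortExact_comp {K Y E E' E'' : C} {k : K ⟶ Y} {p : Y ⟶ E} {wp : k ≫ p = 0}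
    (hp : (ShortComplex.mk k p wp).ShortExact) {i : E' ⟶ E} {q : E ⟶ E''} {wq : i ≫ q = 0}
    (hq : (ShortComplex.mk i q wq).ShortExact) :
    ∃ (L : C) (l : L ⟶ Y) (w : l ≫ p ≫ q = 0) (a : K ⟶ L) (b : L ⟶ E') (w' : a ≫ b = 0),
      (ShortComplex.mk l (p ≫ q) w).ShortExact ∧ (ShortComplex.mk a b w').ShortExact := by
  have : Mono k := hp.mono_f
  have : Epi p := hp.epi_g
  have : Mono i := hq.mono_f
  have : Epi q := hq.epi_g
  let a : K ⟶ kernel (p ≫ q) := kernel.lift _ k (by rw [reassoc_of% wp, zero_comp])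
  let b : kernel (p ≫ q) ⟶ E' := hq.exact.lift (kernel.ι _ ≫ p) (by simp)
  have ha : a ≫ kernel.ι _ = k := kernel.lift_ι _ _ _
  have hb : b ≫ i = kernel.ι _ ≫ p := hq.exact.lift_f _ _
  have hab : a ≫ b = 0 := by
    rw [← cancel_mono i, Category.assoc, hb, reassoc_of% ha, wp, zero_comp]
  refine ⟨kernel (p ≫ q), kernel.ι _, kernel.condition _, a, b, hab,
    { exact := ShortComplex.exact_of_f_is_kernel _ (kernelIsKernel _)
      mono_f := by dsimp; infer_instance
      epi_g := epi_comp p q },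
    { exact := ?_
      mono_f := mono_of_mono_fac ha
      epi_g := ?_ }⟩
  · rw [ShortComplex.exact_iff_exact_up_to_refinements]
    intro A x hx
    have hx' : (x ≫ kernel.ι _) ≫ p = 0 := by
      rw [Category.assoc, ← hb, ← Category.assoc]
      exact (congrArg (· ≫ i) hx).trans zero_comp
    refine ⟨A, 𝟙 _, inferInstance, hp.exact.lift (x ≫ kernel.ι _) hx', ?_⟩
    rw [Category.id_comp, ← cancel_mono (kernel.ι (p ≫ q)), Category.assoc]
    exact ((congrArg (_ ≫ ·) ha).trans (hp.exact.lift_f _ _)).symm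
  · change Epi b
    rw [epi_iff_surjective_up_to_refinements]
    intro A x
    obtain ⟨A', π, hπ, y, hy⟩ := surjective_up_to_refinements_of_epi p (x ≫ i)
    refine ⟨A', π, hπ, kernel.lift _ y ?_, ?_⟩
    · rw [← reassoc_of% hy, wq, comp_zero, comp_zero]
    · rw [← cancel_mono i, Category.assoc, Category.assoc, hb, kernel.lift_ι_assoc, hy]

/-- The horseshoe lemma. -/
lemma exists_shortExact_horseshoe {K' Y' E' K'' Y'' E'' E : C} {i : E' ⟶ E} {q : E ⟶ E''}
    {w : i ≫ q = 0} (hS : (ShortComplex.mk i q w).ShortExact)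
    {k' : K' ⟶ Y'} {p' : Y' ⟶ E'} {w' : k' ≫ p' = 0} (hS' : (ShortComplex.mk k' p' w').ShortExact)
    {k'' : K'' ⟶ Y''} {p'' : Y'' ⟶ E''} {w'' : k'' ≫ p'' = 0}
    (hS'' : (ShortComplex.mk k'' p'' w'').ShortExact) (t : Y'' ⟶ E) (ht : t ≫ q = p'') :
    ∃ (L : C) (l : L ⟶ Y' ⊞ Y'') (wl : l ≫ biprod.desc (p' ≫ i) t = 0) (a : K' ⟶ L)
      (b : L ⟶ K'') (wab : a ≫ b = 0),
      (ShortComplex.mk l _ wl).ShortExact ∧ (ShortComplex.mk a b wab).ShortExact := by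
  have : Mono k' := hS'.mono_f
  have : Epi p' := hS'.epi_g
  have : Mono k'' := hS''.mono_f
  have : Epi p'' := hS''.epi_g
  have : Mono i := hS.mono_f
  have : Epi q := hS.epi_g
  subst ht
  let P : Y' ⊞ Y'' ⟶ E := biprod.desc (p' ≫ i) t
  have hPq : P ≫ q = biprod.snd ≫ t ≫ q := by
    ext <;> simp [P, w]
  let l := kernel.ι P
  have hl : l ≫ P = 0 := kernel.condition P
  let a : K' ⟶ kernel P := kernel.lift _ (k' ≫ biprod.inl) (by simp [P, reassoc_of% w'])
  have ha : a ≫ l = k' ≫ biprod.inl := kernel.lift_ι _ _ _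
  let b : kernel P ⟶ K'' := hS''.exact.lift (l ≫ biprod.snd)
    (by dsimp; rw [Category.assoc, ← hPq, reassoc_of% hl, zero_comp])
  have hb : b ≫ k'' = l ≫ biprod.snd := hS''.exact.lift_f _ _
  have hab : a ≫ b = 0 := by
    rw [← cancel_mono k'', Category.assoc, hb, reassoc_of% ha, biprod.inl_snd, comp_zero, zero_comp]
  have hP : Epi P := by
    rw [epi_iff_surjective_up_to_refinements]
    intro A x
    -- Match the image of `x` in `E''` by an element of `Y''`; the remaining error lies in `E'` and
    -- is hit from `Y'`.
    obtain ⟨A', π, hπ, y, hy⟩ := surjective_up_to_refinements_of_epi (t ≫ q) (x ≫ q)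
    have hz : (π ≫ x - y ≫ t) ≫ q = 0 := by
      rw [Preadditive.sub_comp, Category.assoc, Category.assoc, hy, sub_self]
    obtain ⟨A'', π', hπ', z, hz'⟩ :=
      surjective_up_to_refinements_of_epi p' (hS.exact.lift (π ≫ x - y ≫ t) hz)
    refine ⟨A'', π' ≫ π, epi_comp _ _, biprod.lift z (π' ≫ y), ?_⟩
    have h1 : hS.exact.lift (π ≫ x - y ≫ t) hz ≫ i = π ≫ x - y ≫ t := hS.exact.lift_f _ _
    rw [biprod.lift_desc, ← reassoc_of% hz', h1]
    simp
  refine ⟨kernel P, l, hl, a, b, hab,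
    { exact := ShortComplex.exact_of_f_is_kernel _ (kernelIsKernel _)
      mono_f := by dsimp [l]; infer_instance
      epi_g := hP },
    { exact := ?_
      mono_f := mono_of_mono_fac ha
      epi_g := ?_ }⟩
  · rw [ShortComplex.exact_iff_exact_up_to_refinements]
    intro A x hx
    dsimp at x hx
    have h2 : (x ≫ l) ≫ biprod.snd = 0 := by
      rw [Category.assoc, ← hb, reassoc_of% hx, zero_comp]
    have h1 : x ≫ l = ((x ≫ l) ≫ biprod.fst) ≫ biprod.inl := by
      apply biprod.hom_ext
      · simp
      · rw [h2]
        simp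
    have h3 : ((x ≫ l) ≫ biprod.fst) ≫ p' = 0 := by
      have h4 : (x ≫ l) ≫ P = 0 := by rw [Category.assoc, hl, comp_zero]
      rw [h1, Category.assoc, biprod.inl_desc, ← Category.assoc] at h4
      rw [← cancel_mono i, h4, zero_comp]
    refine ⟨A, 𝟙 _, inferInstance, hS'.exact.lift _ h3, ?_⟩
    have h4 : hS'.exact.lift _ h3 ≫ k' = _ := hS'.exact.lift_f _ _
    change 𝟙 A ≫ x = hS'.exact.lift _ h3 ≫ a
    rw [Category.id_comp, ← cancel_mono l, Category.assoc, ha]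
    exact h1.trans ((congrArg (· ≫ biprod.inl) h4).symm.trans (Category.assoc _ _ _))
  · change Epi b
    rw [epi_iff_surjective_up_to_refinements]
    intro A x
    have h0 : (x ≫ k'' ≫ t) ≫ q = 0 := by simp [w'']
    obtain ⟨A', π, hπ, y, hy⟩ := surjective_up_to_refinements_of_epi p' (hS.exact.lift _ h0)
    have h1 : hS.exact.lift _ h0 ≫ i = x ≫ k'' ≫ t := hS.exact.lift_f _ _
    refine ⟨A', π, hπ, kernel.lift P (biprod.lift (-y) (π ≫ x ≫ k'')) ?_, ?_⟩
    · rw [biprod.lift_desc, Preadditive.neg_comp, ← reassoc_of% hy, h1]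
      simp
    · rw [← cancel_mono k'', Category.assoc, Category.assoc, hb]
      simp [l]

variable [HasCoproducts.{v} C] {T : C}

lemma Emax.of_iso {E E' : C} (h : Emax T E) (e : E ≅ E') : Emax T E' := by
  obtain ⟨h1, K, ⟨e'⟩, h2⟩ := h
  exact ⟨h1.of_retract_right (Retract.ofIso e.symm), K, ⟨e' ≪≫ e⟩, h2⟩

lemma emax_of_addClosure (hT : IsWeaklyTilting T) {M : C} (hM : addClosure T M) : Emax T M := by
  refine IsResolving.emax (R := addClosure T) (fun M hM => ⟨extVanishes_of_addClosure hT hM,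
    -- The kernel 0 is a summand of the empty coproduct, so it belongs to `Add(T)`.
    0, M, 0, 𝟙 M, zero_comp, ?_, hM, PEmpty,
    ⟨{ i := 0, r := 0, retract := (isZero_zero C).eq_of_src _ _ }⟩⟩) hM
  exact
    { exact := (ShortComplex.exact_iff_mono _ rfl).2 (by dsimp; infer_instance)
      mono_f := by dsimp; infer_instance
      epi_g := by dsimp; infer_instance }

/-- Extensions of objects of `E_max(T)` form a resolving class by the horseshoe lemma. The lift it
needs exists although `Y''` need not be projective: `Ext¹(T, E') = 0` lifts morphisms from `T`,
hence from `Add(T)`. -/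
lemma Emax.extension (hT : IsWeaklyTilting T) {S : ShortComplex C} (hS : S.ShortExact)
    (h₁ : Emax T S.X₁) (h₃ : Emax T S.X₃) : Emax T S.X₂ := by
  refine IsResolving.emax (T := T) (R := fun E => ∃ (E' E'' : C) (i : E' ⟶ E) (q : E ⟶ E'')
    (w : i ≫ q = 0), (ShortComplex.mk i q w).ShortExact ∧ Emax T E' ∧ Emax T E'') ?_
    ⟨_, _, S.f, S.g, S.zero, hS, h₁, h₃⟩
  rintro E ⟨E', E'', i, q, w, hS, h', h''⟩
  refine ⟨ExtVanishes.middle hS h'.1 h''.1, ?_⟩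
  obtain ⟨-, K', Y', k', p', w', hS', hY', hK'⟩ := isResolving_emax hT _ h'
  obtain ⟨-, K'', Y'', k'', p'', w'', hS'', hY'', hK''⟩ := isResolving_emax hT _ h''
  obtain ⟨t, ht⟩ := hY''.exists_lift q (ExtVanishes.exists_lift hS h'.1) p''
  obtain ⟨L, l, wl, a, b, wab, hl, hab⟩ := exists_shortExact_horseshoe hS hS' hS'' t ht
  exact ⟨L, _, l, _, wl, hl, hY'.biprod hY'', K', K'', a, b, wab, hab, hK', hK''⟩

/-- Compose an `Add(T)`-cover of `S.X₂` with `S.g`: the kernel is an extension of `S.X₁` by the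
kernel of the cover, hence in `E_max(T)`. So `E_max(T)` with `S.X₃` adjoined is still resolving. -/
lemma Emax.quotient (hT : IsWeaklyTilting T) {S : ShortComplex C} (hS : S.ShortExact)
    (h₁ : Emax T S.X₁) (h₂ : Emax T S.X₂) : Emax T S.X₃ := by
  obtain ⟨-, K, Y, k, p, w, hS', hY, hK⟩ := isResolving_emax hT _ h₂
  obtain ⟨L, l, wl, a, b, wab, hl, hab⟩ := exists_shortExact_comp hS' (i := S.f) (q := S.g)
    (wq := S.zero) hS
  have hL : Emax T L := Emax.extension hT hab hK h₁
  have hE := ExtVanishes.quotient hS h₁.1 h₂.1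
  refine IsResolving.emax (T := T) (R := fun E => Emax T E ∨ E = S.X₃) ?_ (Or.inr rfl)
  rintro E (hE | rfl)
  · obtain ⟨h, K, Y, k, p, w, hS', hY, hK⟩ := isResolving_emax hT _ hE
    exact ⟨h, K, Y, k, p, w, hS', hY, Or.inl hK⟩
  · exact ⟨hE, L, Y, l, _, wl, hl, hY, Or.inl hL⟩

end Emax

/-! ### Passage to the opposite category: `F_max(W)` as `E_max(op W)`. -/

section Duality

variable {D : Type u} [Category.{v} D] [HasProducts.{v} D]

lemma addClosure_op_iff (W M : D) : addClosure (op W) (op M) ↔ prodClosure W M := by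
  refine exists_congr fun X => ⟨fun ⟨r⟩ => ⟨?_⟩, fun ⟨r⟩ => ⟨?_⟩⟩
  · let s := r.trans (Retract.ofIso (opProductIsoCoproduct fun _ : X => W).symm)
    exact
      { i := s.r.unop
        r := s.i.unop
        retract := Quiver.Hom.op_inj s.retract }
  · exact r.op.trans (Retract.ofIso (opProductIsoCoproduct fun _ : X => W))

variable [Abelian D]

/-- The additive functor `Hom(-, W)`, as the functor represented by `W` in the opposite
category. -/
def yonedaIsoCoyoneda (W : D) :
    preadditiveYoneda.obj W ≅ preadditiveCoyoneda.obj (op (op W)) :=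
  NatIso.ofComponents (fun _ => AddEquiv.toAddCommGrpIso
    { toFun := fun f => f.op
      invFun := fun f => f.unop
      left_inv := fun _ => rfl
      right_inv := fun _ => rfl
      map_add' := fun _ _ => rfl }) (fun _ => rfl)

/-- Complexes are simply reversed; enough projectives enter only through the Ext condition. -/
lemma fmax_iff_emax_op [EnoughProjectives D] (W F : D) :
    Fmax W F ↔ Emax (op W) (op F) := by
  refine and_congr (extVanishes_op_iff F W).symm ⟨?_, ?_⟩
  · rintro ⟨K, ⟨e⟩, hK, hK', hKW⟩
    refine ⟨K.op, ⟨e.symm.op⟩, fun j => (addClosure_op_iff W _).2 (hK j), hK'.op, ?_⟩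
    exact fun i => (hKW i).of_iso ((NatIso.mapHomologicalComplex (yonedaIsoCoyoneda W) _).app K.op)
  · rintro ⟨K, ⟨e⟩, hK, hK', hKW⟩
    refine ⟨K.unop, ⟨e.symm.unop⟩, fun j => (addClosure_op_iff W _).1 (hK j), hK'.unop, ?_⟩
    exact fun i => HomologicalComplex.ExactAt.of_iso (hKW i)
      ((NatIso.mapHomologicalComplex (yonedaIsoCoyoneda W) _).app K).symm

lemma isWeaklyCotilting_iff_op [EnoughProjectives D] (W : D) :
    IsWeaklyCotilting W ↔ IsWeaklyTilting (op W) := by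
  refine forall_congr' fun _ => ?_
  rw [← extVanishes_op_iff]
  exact ⟨fun h => h.of_retract_right (Retract.ofIso (opProductIsoCoproduct fun _ => W).symm),
    fun h => h.of_retract_right (Retract.ofIso (opProductIsoCoproduct fun _ => W))⟩

lemma isInfinityCotilting_iff_op [EnoughProjectives D] (W : D) :
    IsInfinityCotilting W ↔ IsInfinityTilting (op W) := by
  refine and_congr (isWeaklyCotilting_iff_op W) ⟨fun h I hI => ?_, fun h P hP => ?_⟩
  · exact (fmax_iff_emax_op W I.unop).1 (h I.unop inferInstance)
  · exact (fmax_iff_emax_op W P).2 (h (op P) inferInstance)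

variable [EnoughProjectives D] {W : D}

lemma Fmax.of_iso {F F' : D} (h : Fmax W F) (e : F ≅ F') : Fmax W F' :=
  (fmax_iff_emax_op W F').2 (((fmax_iff_emax_op W F).1 h).of_iso e.symm.op)

lemma Fmax.extension (hW : IsWeaklyCotilting W) {S : ShortComplex D} (hS : S.ShortExact)
    (h₁ : Fmax W S.X₁) (h₃ : Fmax W S.X₃) : Fmax W S.X₂ :=
  (fmax_iff_emax_op W _).2 (Emax.extension ((isWeaklyCotilting_iff_op W).1 hW) hS.op
    ((fmax_iff_emax_op W _).1 h₃) ((fmax_iff_emax_op W _).1 h₁))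

lemma Fmax.sub (hW : IsWeaklyCotilting W) {S : ShortComplex D} (hS : S.ShortExact)
    (h₂ : Fmax W S.X₂) (h₃ : Fmax W S.X₃) : Fmax W S.X₁ :=
  (fmax_iff_emax_op W _).2 (Emax.quotient ((isWeaklyCotilting_iff_op W).1 hW) hS.op
    ((fmax_iff_emax_op W _).1 h₃) ((fmax_iff_emax_op W _).1 h₂))

/-- Every object of `F_max(W)` embeds into an object of `Prod(W)` with quotient in `F_max(W)`. -/
lemma Fmax.exists_cosyzygy (hW : IsWeaklyCotilting W) {F : D} (hF : Fmax W F) :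
    ∃ (M F' : D) (i : F ⟶ M) (p : M ⟶ F') (w : i ≫ p = 0),
      (ShortComplex.mk i p w).ShortExact ∧ prodClosure W M ∧ Fmax W F' := by
  obtain ⟨-, K, Y, k, p, w, hS, hY, hK⟩ :=
    isResolving_emax ((isWeaklyCotilting_iff_op W).1 hW) _ ((fmax_iff_emax_op W F).1 hF)
  exact ⟨Y.unop, K.unop, p.unop, k.unop, Quiver.Hom.op_inj w, hS.unop,
    (addClosure_op_iff W Y.unop).1 hY, (fmax_iff_emax_op W K.unop).2 hK⟩

lemma Fmax.of_shortExact_prodClosure (R : ObjectProperty D)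
    (hR : ∀ F, R F → ExtVanishes F W ∧ ∃ (M F' : D) (i : F ⟶ M) (p : M ⟶ F') (w : i ≫ p = 0),
      (ShortComplex.mk i p w).ShortExact ∧ prodClosure W M ∧ R F') {F : D} (hF : R F) :
    Fmax W F := by
  refine (fmax_iff_emax_op W F).2 (IsResolving.emax (R := fun E => R E.unop) (fun E hE => ?_) hF)
  obtain ⟨h, M, F', i, p, w, hS, hM, hF'⟩ := hR _ hE
  exact ⟨(extVanishes_op_iff _ _).2 h, op F', op M, p.op, i.op, Quiver.Hom.unop_inj w, hS.op,
    (addClosure_op_iff W M).2 hM, hF'⟩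

end Duality

/-! ### Units and counits: retracts and fullness. -/

section Retracts

variable {C D : Type*} [Category C] [Category D]

lemma isIso_app_of_retract {F G : C ⥤ D} (α : F ⟶ G) {X Y : C} (r : Retract X Y)
    (h : IsIso (α.app Y)) : IsIso (α.app X) :=
  MorphismProperty.of_retract (P := MorphismProperty.isomorphisms D)
    (NatTrans.retractArrowApp α r) h

variable {F : C ⥤ D} {G : D ⥤ C} (adj : F ⊣ G)

lemma isIso_unit_of_isIso_counit {Y : D} (h : IsIso (adj.counit.app Y)) :
    IsIso (adj.unit.app (G.obj Y)) := by
  have : IsIso (adj.unit.app (G.obj Y) ≫ G.map (adj.counit.app Y)) := by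
    have h' := adj.right_triangle_components Y
    rw [h']
    exact inferInstanceAs (IsIso (𝟙 _))
  exact IsIso.of_isIso_comp_right _ (G.map (adj.counit.app Y))

/-- If the counit at `X` is an isomorphism, then `G` is full on morphisms out of `X`. -/
lemma exists_map_eq_of_isIso_counit {X Y : D} (h : IsIso (adj.counit.app X))
    (f : G.obj X ⟶ G.obj Y) : ∃ g : X ⟶ Y, G.map g = f := by
  refine ⟨inv (adj.counit.app X) ≫ (adj.homEquiv _ _).symm f, ?_⟩
  have h1 : G.map (inv (adj.counit.app X)) = adj.unit.app (G.obj X) := by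
    rw [Functor.map_inv, IsIso.inv_eq_of_inv_hom_id]
    exact adj.right_triangle_components X
  rw [G.map_comp, h1, ← adj.homEquiv_unit, Equiv.apply_symm_apply]

/-- By Yoneda: precomposition with the counit is `G.map` followed by the adjunction bijection. -/
lemma isIso_counit_of_map_bijective {X : D}
    (h : ∀ Y : D, Function.Bijective (fun f : X ⟶ Y => G.map f)) : IsIso (adj.counit.app X) := by
  apply isIso_of_coyoneda_map_bijective
  intro Y
  have e : (fun f : X ⟶ Y => adj.counit.app X ≫ f) =
      (adj.homEquiv _ _).symm ∘ fun f => G.map f :=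
    funext fun f => by simp [Adjunction.homEquiv_counit]
  have h' := (adj.homEquiv _ _).symm.bijective.comp (h Y)
  rw [← e] at h'
  exact h'

end Retracts

/-! ### Projective modules over the monad and `Add(T)`. -/

namespace Tilted

variable {A : Type u} [Category.{v} A] [Abelian A] [HasCoproducts.{v} A] {T : A}

/-- `Ψ(T^(X))` is by definition the free module on `X`, so morphisms to `Ψ N` and morphisms `T^(X) ⟶
N` are both families `X → Hom(T, N)`. -/
lemma isIso_counit_coproduct (X : Type v) :
    IsIso ((adjunction T).counit.app (∐ fun _ : X => T)) := by
  refine isIso_counit_of_map_bijective _ fun N => ⟨fun f g h => ?_, fun φ => ?_⟩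
  · ext x
    exact types_congr_hom (congrArg Monad.Algebra.Hom.f h) (Sigma.ι (fun _ : X => T) x)
  · let φ' : (tiltingMonad T).free.obj X ⟶ (Ψ T).obj N := φ
    let a : X → (T ⟶ N) := fun x => φ'.f (Sigma.ι (fun _ : X => T) x)
    refine ⟨Sigma.desc a, free_hom_ext (f := (Ψ T).map (Sigma.desc a)) (g := φ') fun x => ?_⟩
    change Sigma.ι (fun _ : X => T) x ≫ Sigma.desc a = a x
    simp

lemma isIso_counit_of_addClosure {M : A} (hM : addClosure T M) :
    IsIso ((adjunction T).counit.app M) := by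
  obtain ⟨X, ⟨r⟩⟩ := hM
  exact isIso_app_of_retract _ r (isIso_counit_coproduct X)

lemma projective_of_lift {P : Tilted T}
    (h : ∀ {X Y : Tilted T} (f : P ⟶ Y) (p : X ⟶ Y), Function.Surjective (fun x => p.f x) →
      ∃ g : P ⟶ X, g ≫ p = f) : Projective P where
  factors f p _ := h f p (surjective_of_epi p)

instance projective_free (X : Type v) : Projective ((tiltingMonad T).free.obj X) := by
  refine projective_of_lift fun {Y Z} f p hp => ?_
  choose a ha using fun x => hp (f.f (Sigma.ι (fun _ : X => T) x))
  refine ⟨freeDesc a, free_hom_ext fun x => ?_⟩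
  change p.f ((freeDesc a).f _) = _
  rw [freeDesc_ι]
  exact ha x

/-- The presentation of a module by the free module on its underlying set. -/
noncomputable def freeCover (X : Tilted T) : (tiltingMonad T).free.obj X.A ⟶ X :=
  freeDesc id

instance (X : Tilted T) : Epi (freeCover X) :=
  epi_of_surjective _ fun x => ⟨_, freeDesc_ι id x⟩

instance : EnoughProjectives (Tilted T) where
  presentation X := ⟨{ p := _, f := freeCover X }⟩

lemma projective_of_addClosure {M : A} (hM : addClosure T M) : Projective ((Ψ T).obj M) := by
  obtain ⟨X, ⟨r⟩⟩ := hM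
  have : Projective ((Ψ T).obj (∐ fun _ : X => T)) := projective_free X
  exact (r.map (Ψ T)).projective

/-- A projective module is a direct summand of a free module. -/
lemma exists_retract_free (P : Tilted T) [Projective P] :
    ∃ X : Type v, Nonempty (Retract P ((Ψ T).obj (∐ fun _ : X => T))) := by
  let r : Retract P ((tiltingMonad T).free.obj P.A) :=
    { i := Projective.factorThru (𝟙 P) (freeCover P)
      r := freeCover P
      retract := Projective.factorThru_comp _ _ }
  exact ⟨P.A, ⟨r⟩⟩

variable (T) in
theorem restrictsToEquivalence_projective :
    RestrictsToEquivalence (adjunction T) (addClosure T) (fun X => Projective X) where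
  map_right _ hM := projective_of_addClosure hM
  map_left P hP := by
    obtain ⟨X, ⟨r⟩⟩ := exists_retract_free P
    have := isIso_counit_coproduct (T := T) X
    exact ⟨X, ⟨(r.map (Φ T)).trans (Retract.ofIso (asIso ((adjunction T).counit.app _)))⟩⟩
  isIso_counit _ hM := isIso_counit_of_addClosure hM
  isIso_unit P hP := by
    obtain ⟨X, ⟨r⟩⟩ := exists_retract_free P
    exact isIso_app_of_retract _ r (isIso_unit_of_isIso_counit _ (isIso_counit_coproduct X))

/-- Every element `x` of a module is the image of `𝟙 T` under the morphism letting `t : T ⟶ T` act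
on `x`. -/
theorem isSeparator_Ψ {A : Type u} [Category.{v} A] [HasCoproducts.{v} A] [HasCoequalizers A]
    (T : A) : IsSeparator ((Ψ T).obj T) := by
  rw [isSeparator_def]
  intro X Y f g h
  refine hom_ext fun x => ?_
  let φ : (Ψ T).obj T ⟶ X := homMk (X := (Ψ T).obj T)
    (fun t : T ⟶ T => X.act (t ≫ Sigma.ι (fun _ : X.A => T) x)) fun w => by
      change X.act ((w ≫ Sigma.desc id) ≫ _) = _
      have := X.act_desc w (fun t : T ⟶ T => t ≫ Sigma.ι (fun _ : X.A => T) x)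
      refine Eq.trans ?_ this
      have e : Sigma.desc (fun t : T ⟶ T => t) ≫ Sigma.ι (fun _ : X.A => T) x =
          Sigma.desc fun t : T ⟶ T => t ≫ Sigma.ι (fun _ : X.A => T) x := by
        ext
        simp
      exact congrArg X.act ((Category.assoc _ _ _).trans (congrArg (w ≫ ·) e))
  have hφ : φ.f (𝟙 T) = x := by
    change X.act (𝟙 T ≫ _) = x
    rw [Category.id_comp, act_ι]
  rw [← hφ]
  exact types_congr_hom (congrArg Monad.Algebra.Hom.f (h φ)) (𝟙 T)

lemma epi_Ψ_map {M N : A} (p : M ⟶ N) (h : ∀ f : T ⟶ N, ∃ g : T ⟶ M, g ≫ p = f) :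
    Epi ((Ψ T).map p) :=
  epi_of_surjective _ h

lemma exists_lift_of_epi_Ψ_map {M N : A} (p : M ⟶ N) [Epi ((Ψ T).map p)] (f : T ⟶ N) :
    ∃ g : T ⟶ M, g ≫ p = f :=
  surjective_of_epi ((Ψ T).map p) f

lemma shortExact_map_Ψ {S : ShortComplex A} (hS : S.ShortExact)
    (h : ∀ f : T ⟶ S.X₃, ∃ g : T ⟶ S.X₂, g ≫ S.g = f) : (S.map (Ψ T)).ShortExact := by
  have := hS.mono_f
  have := (adjunction T).isRightAdjoint
  exact
    { exact := hS.exact.map_of_mono_of_preservesKernel _ inferInstance inferInstance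
      mono_f := inferInstanceAs (Mono ((Ψ T).map S.f))
      epi_g := epi_Ψ_map _ h }

lemma shortExact_map_Φ {S : ShortComplex (Tilted T)} (hS : S.ShortExact)
    (h : Mono ((Φ T).map S.f)) : (S.map (Φ T)).ShortExact := by
  have := hS.epi_g
  have := (adjunction T).isLeftAdjoint
  exact
    { exact := hS.exact.map_of_epi_of_preservesCokernel _ inferInstance inferInstance
      mono_f := h
      epi_g := inferInstanceAs (Epi ((Φ T).map S.g)) }

end Tilted

/-! ### Five-lemma arguments for units and counits. -/

section Adjunction

variable {C D : Type*} [Category C] [Abelian C] [Category D] [Abelian D] {F : C ⥤ D} {G : D ⥤ C}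
  (adj : F ⊣ G)

omit [Abelian C] [Abelian D] in
lemma epi_counit_of_epi {Y E : D} (p : Y ⟶ E) [Epi p] [IsIso (adj.counit.app Y)] :
    Epi (adj.counit.app E) := by
  have : Epi (F.map (G.map p) ≫ adj.counit.app E) := by
    have h : F.map (G.map p) ≫ adj.counit.app E = adj.counit.app Y ≫ p := adj.counit_naturality p
    rw [h]
    exact epi_comp _ _
  exact epi_of_epi (F.map (G.map p)) _

omit [Abelian C] [Abelian D] in
lemma mono_unit_of_mono {X Y : C} (i : X ⟶ Y) [Mono i] [IsIso (adj.unit.app Y)] :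
    Mono (adj.unit.app X) := by
  have : Mono (adj.unit.app X ≫ G.map (F.map i)) := by
    have h : adj.unit.app X ≫ G.map (F.map i) = i ≫ adj.unit.app Y := adj.unit_naturality i
    rw [h]
    exact mono_comp _ _
  exact mono_of_mono _ (G.map (F.map i))

omit [Abelian C] [Abelian D] in
lemma epi_map_map {X Y : C} (p : X ⟶ Y) [Epi p] [IsIso (adj.unit.app X)]
    [IsIso (adj.unit.app Y)] : Epi (G.map (F.map p)) := by
  have : Epi (adj.unit.app X ≫ G.map (F.map p)) := by
    have h : adj.unit.app X ≫ G.map (F.map p) = p ≫ adj.unit.app Y := adj.unit_naturality p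
    rw [h]
    exact epi_comp _ _
  exact epi_of_epi (adj.unit.app X) _

/-- The inverse is `inv ε_Y ≫ FG(p)` descended along `p`: it kills `i` because `ε_K` is epi. It is
checked on one side only, which gives mono; epi comes from `Y`. -/
lemma isIso_counit_of_shortExact {K Y E : D} {i : K ⟶ Y} {p : Y ⟶ E} {w : i ≫ p = 0}
    (hS : (ShortComplex.mk i p w).ShortExact) [IsIso (adj.counit.app Y)]
    [Epi (adj.counit.app K)] [Epi (G.map p)] : IsIso (adj.counit.app E) := by
  have := adj.isLeftAdjoint
  have := adj.isRightAdjoint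
  have : Epi p := hS.epi_g
  have := epi_counit_of_epi adj p
  let p' : Y ⟶ F.obj (G.obj E) := inv (adj.counit.app Y) ≫ F.map (G.map p)
  have hp' : i ≫ p' = 0 := by
    rw [← cancel_epi (adj.counit.app K)]
    have := adj.counit_naturality i
    rw [← reassoc_of% this, IsIso.hom_inv_id_assoc, ← Functor.map_comp, ← Functor.map_comp, w,
      Functor.map_zero, Functor.map_zero, comp_zero]
  have hid : adj.counit.app E ≫ hS.exact.desc p' hp' = 𝟙 _ := by
    have hq : p ≫ hS.exact.desc p' hp' = p' := hS.exact.g_desc _ _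
    rw [← cancel_epi (F.map (G.map p)), adj.counit_naturality_assoc, hq]
    simp [p']
  have := mono_of_mono_fac hid
  exact isIso_of_mono_of_epi _

lemma isIso_unit_of_shortExact {X Y K : C} {i : X ⟶ Y} {p : Y ⟶ K} {w : i ≫ p = 0}
    (hS : (ShortComplex.mk i p w).ShortExact) [IsIso (adj.unit.app Y)]
    [Mono (adj.unit.app K)] [Mono (F.map i)] : IsIso (adj.unit.app X) := by
  have := adj.isLeftAdjoint
  have := adj.isRightAdjoint
  have : Mono i := hS.mono_f
  have := mono_unit_of_mono adj i
  let i' : G.obj (F.obj X) ⟶ Y := G.map (F.map i) ≫ inv (adj.unit.app Y)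
  have hi' : i' ≫ p = 0 := by
    rw [← cancel_mono (adj.unit.app K), Category.assoc, Category.assoc,
      ← adj.unit_naturality p, IsIso.inv_hom_id_assoc, ← Functor.map_comp,
      ← Functor.map_comp, w, Functor.map_zero, Functor.map_zero, zero_comp]
  have hid : hS.exact.lift i' hi' ≫ adj.unit.app X = 𝟙 _ := by
    have hq : hS.exact.lift i' hi' ≫ i = i' := hS.exact.lift_f _ _
    rw [← cancel_mono (G.map (F.map i)), Category.assoc, adj.unit_naturality, reassoc_of% hq]
    simp [i']
  have := epi_of_epi_fac hid
  exact isIso_of_mono_of_epi _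

end Adjunction

/-! ### The equivalence between `E_max(T)` and `F_max(W)`. -/

namespace Tilted

section General

variable {A : Type u} [Category.{v} A] [HasCoproducts.{v} A] [HasCoequalizers A] {T J : A}

/-- Monomorphy is tested on morphisms `Φ X ⟶ J`, which by adjunction are morphisms `X ⟶ Ψ J` and so
extend along `i`. -/
lemma mono_Φ_map (hJ : IsCoseparator J) {X Y : Tilted T} (i : X ⟶ Y)
    (h : ∀ f : X ⟶ (Ψ T).obj J, ∃ g : Y ⟶ (Ψ T).obj J, i ≫ g = f) : Mono ((Φ T).map i) := by
  rw [isCoseparator_def] at hJ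
  refine ⟨fun {Z} a b hab => hJ _ _ fun f => ?_⟩
  obtain ⟨g, hg⟩ := h ((adjunction T).homEquiv _ _ f)
  have hf : f = (Φ T).map i ≫ ((adjunction T).homEquiv _ _).symm g := by
    rw [← Adjunction.homEquiv_naturality_left_symm, hg, Equiv.symm_apply_apply]
  rw [hf, reassoc_of% hab]

variable [HasProducts.{v} A]

variable (T J) in
/-- The functor `Ψ` preserves powers. -/
noncomputable def Ψpower (X : Type v) :
    (Ψ T).obj (∏ᶜ fun _ : X => J) ≅ ∏ᶜ fun _ : X => (Ψ T).obj J :=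
  have := (adjunction T).isRightAdjoint
  PreservesProduct.iso (Ψ T) fun _ : X => J

lemma prodClosure_Ψ_power (X : Type v) :
    prodClosure ((Ψ T).obj J) ((Ψ T).obj (∏ᶜ fun _ : X => J)) :=
  ⟨X, ⟨Retract.ofIso (Ψpower T J X)⟩⟩

lemma exists_retract_of_prodClosure {M : Tilted T} (hM : prodClosure ((Ψ T).obj J) M) :
    ∃ X : Type v, Nonempty (Retract M ((Ψ T).obj (∏ᶜ fun _ : X => J))) := by
  obtain ⟨X, ⟨r⟩⟩ := hM
  exact ⟨X, ⟨r.trans (Retract.ofIso (Ψpower T J X).symm)⟩⟩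

end General

section WeaklyTilting

variable {A : Type u} [Category.{v} A] [Abelian A] [HasCoproducts.{v} A] {T J : A}

lemma shortExact_map_Ψ_of_emax {S : ShortComplex A} (hS : S.ShortExact) (h : Emax T S.X₁) :
    (S.map (Ψ T)).ShortExact :=
  Tilted.shortExact_map_Ψ hS (ExtVanishes.exists_lift hS h.1)

/-- Covers from `Add(T)` first make all counits on `E_max(T)` epi; applied to the kernel of a cover,
this is the input of `isIso_counit_of_shortExact`. -/
lemma isIso_counit_of_emax (hT : IsWeaklyTilting T) {E : A} (hE : Emax T E) :
    IsIso ((adjunction T).counit.app E) := by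
  have hepi : ∀ {E : A}, Emax T E → Epi ((adjunction T).counit.app E) := fun {E} hE => by
    obtain ⟨-, K, Y, i, p, w, hS, hY, hK⟩ := isResolving_emax hT E hE
    have := isIso_counit_of_addClosure hY
    have : Epi p := hS.epi_g
    exact epi_counit_of_epi (adjunction T) p
  obtain ⟨-, K, Y, i, p, w, hS, hY, hK⟩ := isResolving_emax hT E hE
  have := isIso_counit_of_addClosure hY
  have := hepi hK
  have : Epi ((Ψ T).map p) := (shortExact_map_Ψ_of_emax hS hK).epi_g
  exact isIso_counit_of_shortExact (adjunction T) hS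

/-- `Ψ` makes `Add(T)`-presentations projective presentations. A morphism from a syzygy `Ψ K` to `Ψ
I` comes from some `K ⟶ I` and extends because `I` is injective. -/
lemma extVanishes_Ψ (hT : IsWeaklyTilting T) {E : A} (hE : Emax T E) (I : A) [Injective I] :
    ExtVanishes ((Ψ T).obj E) ((Ψ T).obj I) := by
  refine extVanishes_of_syzygies (fun X => ∃ E, Emax T E ∧ (Ψ T).obj E = X) _ ?_ ⟨E, hE, rfl⟩
  rintro _ ⟨E, hE, rfl⟩
  obtain ⟨-, K, Y, i, p, w, hS, hY, hK⟩ := isResolving_emax hT E hE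
  refine ⟨_, shortExact_map_Ψ_of_emax hS hK, rfl, ⟨K, hK, rfl⟩, projective_of_addClosure hY,
    fun f => ?_⟩
  obtain ⟨g, rfl⟩ :=
    exists_map_eq_of_isIso_counit (adjunction T) (isIso_counit_of_emax hT hK) f
  have : Mono i := hS.mono_f
  exact ⟨(Ψ T).map (Injective.factorThru g i),
    ((Ψ T).map_comp _ _).symm.trans (congrArg _ (Injective.comp_factorThru g i))⟩

lemma shortExact_map_Φ_of_fmax (hJ : IsCoseparator J) {S : ShortComplex (Tilted T)} (hS : S.ShortExact)
    (h : Fmax ((Ψ T).obj J) S.X₃) : (S.map (Φ T)).ShortExact :=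
  Tilted.shortExact_map_Φ hS (mono_Φ_map hJ _ (ExtVanishes.exists_desc hS h.1))

end WeaklyTilting

section InfinityTilting

variable {A : Type u} [Category.{v} A] [Abelian A] [HasLimits A] [HasColimits A] {T J : A}

variable [Injective J] (hJ : IsCoseparator J) (hT : IsInfinityTilting T)

include hT

lemma isWeaklyCotilting_Ψ : IsWeaklyCotilting ((Ψ T).obj J) := fun X =>
  (extVanishes_Ψ hT.1 (hT.2 (∏ᶜ fun _ : X => J) inferInstance) J).of_retract_left
    (Retract.ofIso (Ψpower T J X).symm)

lemma isIso_unit_of_prodClosure {M : Tilted T} (hM : prodClosure ((Ψ T).obj J) M) :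
    IsIso ((adjunction T).unit.app M) := by
  obtain ⟨X, ⟨r⟩⟩ := exists_retract_of_prodClosure hM
  exact isIso_app_of_retract _ r (isIso_unit_of_isIso_counit _
    (isIso_counit_of_emax hT.1 (hT.2 (∏ᶜ fun _ : X => J) inferInstance)))

lemma injective_Φ_of_prodClosure {M : Tilted T} (hM : prodClosure ((Ψ T).obj J) M) :
    Injective ((Φ T).obj M) := by
  obtain ⟨X, ⟨r⟩⟩ := exists_retract_of_prodClosure hM
  have := isIso_counit_of_emax hT.1 (hT.2 (∏ᶜ fun _ : X => J) inferInstance)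
  exact ((r.map (Φ T)).trans (Retract.ofIso (asIso ((adjunction T).counit.app _)))).injective

include hJ

/-- `E` embeds into a power of `J`. That power is injective, hence in `E_max(T)`, and so is the
cokernel by `Emax.quotient`; `Ψ` keeps the sequence exact, and the construction repeats. -/
lemma fmax_Ψ {E : A} (hE : Emax T E) : Fmax ((Ψ T).obj J) ((Ψ T).obj E) := by
  refine Fmax.of_shortExact_prodClosure (fun F => ∃ E, Emax T E ∧ (Ψ T).obj E = F) ?_ ⟨E, hE, rfl⟩
  rintro _ ⟨E, hE, rfl⟩
  refine ⟨extVanishes_Ψ hT.1 hE J, ?_⟩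
  have hm := (isCoseparator_iff_mono J).1 hJ E
  let S : ShortComplex A := ShortComplex.mk _ _ (cokernel.condition (Pi.lift fun f : E ⟶ J => f))
  have hS : S.ShortExact :=
    { exact := ShortComplex.exact_of_g_is_cokernel _ (cokernelIsCokernel _)
      mono_f := hm
      epi_g := by dsimp [S]; infer_instance }
  exact ⟨_, _, _, _, _, shortExact_map_Ψ_of_emax hS hE, prodClosure_Ψ_power _, S.X₃,
    Emax.quotient hT.1 hS hE (hT.2 _ (inferInstanceAs (Injective (∏ᶜ fun _ : E ⟶ J => J)))), rfl⟩

lemma isIso_unit_of_fmax {F : Tilted T} (hF : Fmax ((Ψ T).obj J) F) :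
    IsIso ((adjunction T).unit.app F) := by
  have hmono : ∀ {F : Tilted T}, Fmax ((Ψ T).obj J) F → Mono ((adjunction T).unit.app F) :=
    fun {F} hF => by
      obtain ⟨Y, K, i, p, w, hS, hY, hK⟩ := Fmax.exists_cosyzygy (isWeaklyCotilting_Ψ hT) hF
      have := isIso_unit_of_prodClosure hT hY
      have : Mono i := hS.mono_f
      exact mono_unit_of_mono (adjunction T) i
  obtain ⟨Y, K, i, p, w, hS, hY, hK⟩ := Fmax.exists_cosyzygy (isWeaklyCotilting_Ψ hT) hF
  have := isIso_unit_of_prodClosure hT hY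
  have := hmono hK
  have : Mono ((Φ T).map i) := (shortExact_map_Φ_of_fmax hJ hS hK).mono_f
  exact isIso_unit_of_shortExact (adjunction T) hS

/-- `Φ` makes `Prod(W)`-copresentations injective copresentations. As the units are invertible,
`ΨΦ(p)` is epi like `p`, which says that morphisms from `T` lift along `Φ(p)`. -/
lemma extVanishes_Φ {F : Tilted T} (hF : Fmax ((Ψ T).obj J) F) :
    ExtVanishes T ((Φ T).obj F) := by
  refine extVanishes_of_cosyzygies (fun E => ∃ F, Fmax ((Ψ T).obj J) F ∧ (Φ T).obj F = E) _ ?_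
    ⟨F, hF, rfl⟩
  rintro _ ⟨F, hF, rfl⟩
  obtain ⟨Y, K, i, p, w, hS, hY, hK⟩ := Fmax.exists_cosyzygy (isWeaklyCotilting_Ψ hT) hF
  refine ⟨_, shortExact_map_Φ_of_fmax hJ hS hK, rfl, ⟨K, hK, rfl⟩,
    injective_Φ_of_prodClosure hT hY, fun f => ?_⟩
  have := isIso_unit_of_prodClosure hT hY
  have := isIso_unit_of_fmax hJ hT hK
  have : Epi p := hS.epi_g
  have : Epi ((Ψ T).map ((Φ T).map p)) := epi_map_map (adjunction T) p
  exact exists_lift_of_epi_Ψ_map ((Φ T).map p) f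

/-- Apply `Φ` to a projective presentation of `F`: the projective goes into `Add(T)`, and its syzygy
stays in `F_max(W)` by `Fmax.sub`, since projectives are `Ψ` of objects of `Add(T)`. -/
lemma emax_Φ {F : Tilted T} (hF : Fmax ((Ψ T).obj J) F) : Emax T ((Φ T).obj F) := by
  refine IsResolving.emax (R := fun E => ∃ F, Fmax ((Ψ T).obj J) F ∧ (Φ T).obj F = E) ?_
    ⟨F, hF, rfl⟩
  rintro _ ⟨F, hF, rfl⟩
  refine ⟨extVanishes_Φ hJ hT hF, ?_⟩
  obtain ⟨S, hS, rfl, hP⟩ := exists_syzygy F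
  have hadd := (restrictsToEquivalence_projective T).map_left _ hP
  have := (restrictsToEquivalence_projective T).isIso_unit _ hP
  have h₂ : Fmax ((Ψ T).obj J) S.X₂ := (fmax_Ψ hJ hT (emax_of_addClosure hT.1 hadd)).of_iso
    (asIso ((adjunction T).unit.app S.X₂)).symm
  exact ⟨_, _, _, _, _, shortExact_map_Φ_of_fmax hJ hS hF, hadd, S.X₁,
    Fmax.sub (isWeaklyCotilting_Ψ hT) hS h₂ hF, rfl⟩

lemma isInfinityCotilting_Ψ : IsInfinityCotilting ((Ψ T).obj J) := by
  refine ⟨isWeaklyCotilting_Ψ hT, fun P hP => ?_⟩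
  have := (restrictsToEquivalence_projective T).isIso_unit _ hP
  exact (fmax_Ψ hJ hT (emax_of_addClosure hT.1
    ((restrictsToEquivalence_projective T).map_left _ hP))).of_iso
    (asIso ((adjunction T).unit.app P)).symm

theorem restrictsToExactEquivalence :
    RestrictsToExactEquivalence (adjunction T) (Emax T) (Fmax ((Ψ T).obj J)) where
  map_right _ hE := fmax_Ψ hJ hT hE
  map_left _ hF := emax_Φ hJ hT hF
  isIso_counit _ hE := isIso_counit_of_emax hT.1 hE
  isIso_unit _ hF := isIso_unit_of_fmax hJ hT hF
  isClosedUnderExtensions_right := ⟨fun hS h₁ h₃ => Emax.extension hT.1 hS h₁ h₃⟩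
  isClosedUnderExtensions_left :=
    ⟨fun hS h₁ h₃ => Fmax.extension (isWeaklyCotilting_Ψ hT) hS h₁ h₃⟩
  exact_right _ h₁ _ _ hS := shortExact_map_Ψ_of_emax hS h₁
  exact_left _ _ _ h₃ hS := shortExact_map_Φ_of_fmax hJ hS h₃

end InfinityTilting

end Tilted

section Duality

variable {C : Type u} [Category.{v} C] [HasCoproducts.{v} C]

lemma enoughProjectives_of_isSeparator {P : C} [Projective P] (hP : IsSeparator P) :
    EnoughProjectives C where
  presentation X :=
    have := (isSeparator_iff_epi P).1 hP X
    ⟨{ p := ∐ fun _ : P ⟶ X => P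
       f := Sigma.desc fun f : P ⟶ X => f }⟩

end Duality

/-! ### The cotilting half, by duality. -/

namespace Cotilted

section Equivalence

variable {B : Type u} [Category.{v} B] [HasProducts.{v} B] [HasEqualizers B] {W : B}

lemma restrictsToEquivalence_of_op {E : ObjectProperty (Cotilted W)} {F : ObjectProperty B}
    {E' : ObjectProperty Bᵒᵖ} {F' : ObjectProperty (Tilted (op W))}
    (hE : ∀ X, E X ↔ F' X.unop) (hF : ∀ Y, F Y ↔ E' (op Y))
    (h : RestrictsToEquivalence (Tilted.adjunction (op W)) E' F') :
    RestrictsToEquivalence (adjunction W) E F where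
  map_right X hX := (hF _).2 (h.map_left _ ((hE X).1 hX))
  map_left Y hY := (hE _).2 (h.map_right _ ((hF Y).1 hY))
  isIso_counit X hX :=
    have := h.isIso_unit _ ((hE X).1 hX)
    inferInstanceAs (IsIso ((Tilted.adjunction (op W)).unit.app X.unop).op)
  isIso_unit Y hY :=
    have := h.isIso_counit _ ((hF Y).1 hY)
    inferInstanceAs (IsIso ((Tilted.adjunction (op W)).counit.app (op Y)).unop)

end Equivalence

theorem restrictsToEquivalence_injective {B : Type u} [Category.{v} B] [Abelian B]
    [HasProducts.{v} B] (W : B) :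
    RestrictsToEquivalence (adjunction W) (fun X => Injective X) (prodClosure W) :=
  restrictsToEquivalence_of_op (fun _ => Injective.projective_iff_injective_op.symm)
    (fun Y => (addClosure_op_iff W Y).symm) (Tilted.restrictsToEquivalence_projective (op W))

variable {B : Type u} [Category.{v} B] [Abelian B] [HasLimits B] [HasColimits B] {P W : B}
  [Projective P] (hP : IsSeparator P) (hW : IsInfinityCotilting W)

include hP hW

/-- Duality is used twice: on the given category, with enough projectives from the generator, and on
`Tilted (op W)`, with enough projectives from free modules. -/
lemma isInfinityTilting_Φ : IsInfinityTilting ((Φ W).obj P) := by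
  have := enoughProjectives_of_isSeparator hP
  exact (isInfinityCotilting_iff_op ((Tilted.Ψ (op W)).obj (op P))).1
    (Tilted.isInfinityCotilting_Ψ ((isCoseparator_op_iff P).2 hP)
      ((isInfinityCotilting_iff_op W).1 hW))

theorem restrictsToExactEquivalence :
    RestrictsToExactEquivalence (adjunction W) (Emax ((Φ W).obj P)) (Fmax W) := by
  have := enoughProjectives_of_isSeparator hP
  have h := Tilted.restrictsToExactEquivalence (J := op P) ((isCoseparator_op_iff P).2 hP)
    ((isInfinityCotilting_iff_op W).1 hW)
  have hE (X : Cotilted W) :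
      Emax ((Φ W).obj P) X ↔ Fmax ((Tilted.Ψ (op W)).obj (op P)) X.unop :=
    (fmax_iff_emax_op _ X.unop).symm
  have hF := fmax_iff_emax_op W
  exact
    { restrictsToEquivalence_of_op hE hF h.toRestrictsToEquivalence with
      isClosedUnderExtensions_right :=
        ⟨fun hS h₁ h₃ => Emax.extension (isInfinityTilting_Φ hP hW).1 hS h₁ h₃⟩
      isClosedUnderExtensions_left := ⟨fun hS h₁ h₃ => Fmax.extension hW.1 hS h₁ h₃⟩
      -- Passing to opposites swaps the two functors and reverses sequences, so `h₁` and `h₃` trade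
      -- places.
      exact_right := fun S h₁ h₂ h₃ hS => (h.exact_left S.unop ((hE _).1 h₃) ((hE _).1 h₂)
        ((hE _).1 h₁) hS.unop).unop
      exact_left := fun S h₁ h₂ h₃ hS => (h.exact_right S.op ((hF _).1 h₃) ((hF _).1 h₂)
        ((hF _).1 h₁) hS.op).op }

end Cotilted

end TiltingTheory

open TiltingTheory in
theorem theorem2p3 (C : Type u) [Category.{v} C] [Abelian C] [HasLimits C] [HasColimits C] :
    (∀ J T : C, Injective J → IsCoseparator J → IsInfinityTilting T →
      EnoughProjectives (Tilted T) ∧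
      RestrictsToEquivalence (Tilted.adjunction T) (addClosure T) (fun X => Projective X) ∧
      Projective ((Tilted.Ψ T).obj T) ∧
      IsSeparator ((Tilted.Ψ T).obj T) ∧
      IsInfinityCotilting ((Tilted.Ψ T).obj J) ∧
      RestrictsToExactEquivalence (Tilted.adjunction T) (Emax T) (Fmax ((Tilted.Ψ T).obj J)) ∧
      Emax T T ∧ Emax T J ∧
      Fmax ((Tilted.Ψ T).obj J) ((Tilted.Ψ T).obj T) ∧
      Fmax ((Tilted.Ψ T).obj J) ((Tilted.Ψ T).obj J) ∧
      Nonempty ((Tilted.Φ T).obj ((Tilted.Ψ T).obj T) ≅ T) ∧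
      Nonempty ((Tilted.Φ T).obj ((Tilted.Ψ T).obj J) ≅ J)) ∧
    (∀ P W : C, Projective P → IsSeparator P → IsInfinityCotilting W →
      EnoughInjectives (Cotilted W) ∧
      RestrictsToEquivalence (Cotilted.adjunction W) (fun X => Injective X) (prodClosure W) ∧
      Injective ((Cotilted.Φ W).obj W) ∧
      IsCoseparator ((Cotilted.Φ W).obj W) ∧
      IsInfinityTilting ((Cotilted.Φ W).obj P) ∧
      RestrictsToExactEquivalence (Cotilted.adjunction W) (Emax ((Cotilted.Φ W).obj P)) (Fmax W) ∧
      Fmax W W ∧ Fmax W P ∧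
      Emax ((Cotilted.Φ W).obj P) ((Cotilted.Φ W).obj W) ∧
      Emax ((Cotilted.Φ W).obj P) ((Cotilted.Φ W).obj P) ∧
      Nonempty ((Cotilted.Ψ W).obj ((Cotilted.Φ W).obj W) ≅ W) ∧
      Nonempty ((Cotilted.Ψ W).obj ((Cotilted.Φ W).obj P) ≅ P)) := by
  refine ⟨fun J T hJ hJ' hT => ?_, fun P W hP hP' hW => ?_⟩
  · have h := Tilted.restrictsToExactEquivalence hJ' hT
    have hET := emax_of_addClosure hT.1 (addClosure_self T)
    have hEJ := hT.2 J hJ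
    have := h.isIso_counit T hET
    have := h.isIso_counit J hEJ
    exact ⟨inferInstance, Tilted.restrictsToEquivalence_projective T,
      Tilted.projective_of_addClosure (addClosure_self T), Tilted.isSeparator_Ψ T,
      Tilted.isInfinityCotilting_Ψ hJ' hT, h, hET, hEJ, h.map_right T hET, h.map_right J hEJ,
      ⟨asIso ((Tilted.adjunction T).counit.app T)⟩, ⟨asIso ((Tilted.adjunction T).counit.app J)⟩⟩
  · have := enoughProjectives_of_isSeparator hP'
    have h := Cotilted.restrictsToExactEquivalence hP' hW
    have hFW := (fmax_iff_emax_op W W).2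
      (emax_of_addClosure ((isWeaklyCotilting_iff_op W).1 hW.1) (addClosure_self (op W)))
    have hFP := hW.2 P hP
    have := h.isIso_unit W hFW
    have := h.isIso_unit P hFP
    have hproj : Projective ((Tilted.Ψ (op W)).obj (op W)) :=
      Tilted.projective_of_addClosure (addClosure_self (op W))
    exact ⟨inferInstance, Cotilted.restrictsToEquivalence_injective W,
      inferInstanceAs (Injective (op ((Tilted.Ψ (op W)).obj (op W)))),
      (isCoseparator_op_iff _).2 (Tilted.isSeparator_Ψ (op W)),
      Cotilted.isInfinityTilting_Φ hP' hW, h, hFW, hFP, h.map_left W hFW, h.map_left P hFP,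
      ⟨(asIso ((Cotilted.adjunction W).unit.app W)).symm⟩,
      ⟨(asIso ((Cotilted.adjunction W).unit.app P)).symm⟩⟩
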